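/- Let $K$ be a number field, let $m,k\ge 0$ be integers and let $A\in M_m(K)$. Then there is a polynomial $P\in K[x_1,\dots,x_m]$, depending only on $A$ (and $k$), such that the following holds. Let $p$ be a prime, let $K_v$ be a finite extension of $\mathbb{Q}_p$ together with an embedding $K\subset K_v$, let $G_{K_v}=\mathrm{Gal}(\overline{K_v}/K_v)$, and let $\chi_{\mathrm{cycl}}:G_{K_v}\to\mathbb{Z}_p^\times$ be the cyclotomic character. Let $V_{\text{ét}}$ be a finite-dimensional $\mathbb{Q}_p$-vector space with a continuous linear action of $G_{K_v}$ which is $B_{\mathrm{dR}}$-admissible, i.e. with $V_{\mathrm{dR},K_v}:=(V_{\text{ét}}\otimes_{\mathbb{Q}_p}B_{\mathrm{dR}})^{G_{K_v}}$ the natural map $V_{\mathrm{dR},K_v}\otimes_{K_v}B_{\mathrm{dR}}\to V_{\text{ét}}\otimes_{\mathbb{Q}_p}B_{\mathrm{dR}}$ is an isomorphism. Let $V_{\mathrm{dR}}$ be a $K$-structure on $V_{\mathrm{dR},K_v}$, i.e. a $K$-vector space with an isomorphism $V_{\mathrm{dR}}\otimes_K K_v\simeq V_{\mathrm{dR},K_v}$,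 and let $a\in\mathbb{Z}$. Suppose that - $\tau:V_{\text{ét}}\to V_{\text{ét}}$ is a $G_{K_v}$-equivariant endomorphism whose de Rham realization $(\tau\otimes 1)|_{V_{\mathrm{dR},K_v}}$ is induced by a $K$-linear endomorphism of $V_{\mathrm{dR}}$; - $\hat\gamma^*:V_{\text{ét}}\to\mathbb{Q}_p(a)$ is a $\mathbb{Q}_p$-linear functional on which $G_{K_v}$ acts through $\chi_{\mathrm{cycl}}^{-a}$, i.e. $g\cdot\hat\gamma^*=\chi_{\mathrm{cycl}}(g)^{-a}\,\hat\gamma^*$ in $\mathrm{Hom}(V_{\text{ét}},\mathbb{Q}_p(a))$ for all $g$; - the dimension over $\mathbb{Q}_p$ of the $G_{K_v}$-invariant subspace of $\mathrm{Hom}(V_{\text{ét}},\mathbb{Q}_p(2a))$ is equal to $k$, and $k$ is less than the degree of the minimal polynomial of $\tau$. Let $\omega_1,\dots,\omega_m$ be any basis of $V_{\mathrm{dR}}$ in which $\tau$ has the matrix $A$. For a functional $\varphi:V_{\text{ét}}\to\mathbb{Q}_p(b)$ let $\varphi_{B_{\mathrm{dR}}}:V_{\text{ét}}\otimes_{\mathbb{Q}_p}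 B_{\mathrm{dR}}\to B_{\mathrm{dR}}$ be its $B_{\mathrm{dR}}$-linear extension along the map $\mathbb{Q}_p(b)\hookrightarrow B_{\mathrm{dR}}$ that sends the standard generator to $t^b$, where $t=\log[\varepsilon]$ is the $p$-adic period attached to a compatible system $\varepsilon$ of $p$-power roots of unity, and let $(\varphi_{B_{\mathrm{dR}}}(\omega_1),\dots,\varphi_{B_{\mathrm{dR}}}(\omega_m))\in B_{\mathrm{dR}}^m$ be its dual coordinates. Then $P$ is homogeneous of degree exactly $k+1$; it satisfies $$P\bigl(\hat\gamma^*_{B_{\mathrm{dR}}}(\omega_1),\dots,\hat\gamma^*_{B_{\mathrm{dR}}}(\omega_m)\bigr)=0;$$ and this relation does not hold for a generic functional: the set of $\varphi\in\mathrm{Hom}_{\mathbb{Q}_p}(V_{\text{ét}},\mathbb{Q}_p)$ with $P(\varphi_{B_{\mathrm{dR}}}(\omega_1),\dots,\varphi_{B_{\mathrm{dR}}}(\omega_m))\ne 0$ contains a non-empty Zariski open subset of the affine space $\mathrm{Hom}_{\mathbb{Q}_p}(V_{\text{ét}},\mathbb{Q}_p)$. -/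

import Mathlib

open scoped TensorProduct
set_option linter.unusedSectionVars false

namespace PadicHodge
noncomputable section

section IntegersOfCp
variable (p : ℕ) [hp : Fact p.Prime]

lemma valued_eq_nnnorm (x : ℂ_[p]) : Valued.v x = ‖x‖₊ := by
  ext
  have := PadicComplex.norm_eq_norm p x
  rw [coe_nnnorm, this, Valued.v.norm_def, PadicComplex.RankOne.hom_eq_embedding,
    Valuation.embedding_restrict]

lemma mem_integers_iff {x : ℂ_[p]} : x ∈ 𝓞_ℂ_[p] ↔ ‖x‖ ≤ 1 := by
  change Valued.v x ≤ 1 ↔ _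
  rw [valued_eq_nnnorm, ← NNReal.coe_le_coe]; rfl

lemma norm_p : ‖(p : ℂ_[p])‖ = (p : ℝ)⁻¹ := by
  rw [← coe_nnnorm, ← valued_eq_nnnorm, PadicComplex.valuation_p]; simp

lemma norm_p_lt_one : ‖(p : ℂ_[p])‖ < 1 := by
  rw [norm_p]; exact inv_lt_one_of_one_lt₀ (mod_cast hp.out.one_lt)

instance : Fact (¬ IsUnit (p : 𝓞_ℂ_[p])) := ⟨by
  rintro ⟨u, hu⟩
  have h1 : (p : ℂ_[p]) * ((u⁻¹ : (𝓞_ℂ_[p])ˣ) : 𝓞_ℂ_[p]) = 1 := by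
    have := u.mul_inv
    rw [hu] at this
    simpa using congrArg (Subtype.val) this
  have h2 : ‖(((u⁻¹ : (𝓞_ℂ_[p])ˣ) : 𝓞_ℂ_[p]) : ℂ_[p])‖ ≤ 1 := (mem_integers_iff p).1 (SetLike.coe_mem _)
  have h3 := congrArg norm h1
  rw [norm_mul, norm_one] at h3
  nlinarith [norm_p_lt_one p, norm_nonneg (p : ℂ_[p])]⟩

lemma mem_span_p_pow_iff {x : 𝓞_ℂ_[p]} {n : ℕ} :
    x ∈ (Ideal.span {(p : 𝓞_ℂ_[p])}) ^ n ↔ ‖(x : ℂ_[p])‖ ≤ (p : ℝ)⁻¹ ^ n := by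
  have hp0 : (p : ℂ_[p]) ≠ 0 := by exact_mod_cast hp.out.ne_zero
  rw [Ideal.span_singleton_pow, Ideal.mem_span_singleton]
  constructor
  · rintro ⟨y, rfl⟩
    have : ‖(y : ℂ_[p])‖ ≤ 1 := (mem_integers_iff p).1 y.2
    push_cast
    rw [norm_mul, norm_pow, norm_p]
    exact mul_le_of_le_one_right (by positivity) this
  · intro h
    refine ⟨⟨(x : ℂ_[p]) / (p : ℂ_[p]) ^ n, (mem_integers_iff p).2 ?_⟩, ?_⟩
    · rw [norm_div, norm_pow, norm_p]
      exact div_le_one_of_le₀ h (by positivity)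
    · ext
      push_cast
      field_simp

instance : IsAdicComplete (Ideal.span {(p : 𝓞_ℂ_[p])}) 𝓞_ℂ_[p] where
  haus' x hx := by
    have h : ∀ n : ℕ, ‖(x : ℂ_[p])‖ ≤ (p : ℝ)⁻¹ ^ n := fun n => by
      have := hx n
      rw [SModEq.zero, smul_eq_mul, Ideal.mul_top] at this
      exact (mem_span_p_pow_iff p).1 this
    have h0 : Filter.Tendsto (fun n : ℕ => (p : ℝ)⁻¹ ^ n) Filter.atTop (nhds 0) :=
      tendsto_pow_atTop_nhds_zero_of_lt_one (by positivity)
        (inv_lt_one_of_one_lt₀ (mod_cast hp.out.one_lt))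
    have := ge_of_tendsto' h0 h
    ext
    simpa using this
  prec' f hf := by
    have h : ∀ m n : ℕ, m ≤ n → ‖(f m : ℂ_[p]) - f n‖ ≤ (p : ℝ)⁻¹ ^ m := fun m n hmn => by
      have := hf hmn
      rw [SModEq.sub_mem, smul_eq_mul, Ideal.mul_top] at this
      simpa using (mem_span_p_pow_iff p).1 this
    have h0 : Filter.Tendsto (fun n : ℕ => (p : ℝ)⁻¹ ^ n) Filter.atTop (nhds 0) :=
      tendsto_pow_atTop_nhds_zero_of_lt_one (by positivity)
        (inv_lt_one_of_one_lt₀ (mod_cast hp.out.one_lt))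
    have hc : CauchySeq (fun n => (f n : ℂ_[p])) :=
      cauchySeq_of_le_tendsto_0' _ (fun n m hnm => by rw [dist_eq_norm]; exact h n m hnm) h0
    obtain ⟨L, hL⟩ := cauchySeq_tendsto_of_complete hc
    have hfL : ∀ n, ‖(f n : ℂ_[p]) - L‖ ≤ (p : ℝ)⁻¹ ^ n := fun n =>
      le_of_tendsto ((tendsto_const_nhds.sub hL).norm)
        (Filter.eventually_atTop.2 ⟨n, fun m hm => h n m hm⟩)
    have hLi : L ∈ 𝓞_ℂ_[p] := (mem_integers_iff p).2 <|
      le_of_tendsto hL.norm (Filter.Eventually.of_forall fun n => (mem_integers_iff p).1 (f n).2)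
    refine ⟨⟨L, hLi⟩, fun n => ?_⟩
    rw [SModEq.sub_mem, smul_eq_mul, Ideal.mul_top, mem_span_p_pow_iff]
    simpa using hfL n

/-- `𝓞_ℂ_[p][1/p] = ℂ_[p]`. -/
instance : IsLocalization.Away (p : 𝓞_ℂ_[p]) ℂ_[p] := by
  have hp0 : (p : ℂ_[p]) ≠ 0 := by exact_mod_cast hp.out.ne_zero
  have hpm : ∀ y : Submonoid.powers (p : 𝓞_ℂ_[p]), ∃ n, ((y : 𝓞_ℂ_[p]) : ℂ_[p]) = (p : ℂ_[p]) ^ n := by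
    rintro ⟨_, n, rfl⟩
    exact ⟨n, by simp⟩
  refine ⟨fun y => ?_, fun z => ?_, fun {x y} h => ⟨1, ?_⟩⟩
  · obtain ⟨n, hn⟩ := hpm y
    change IsUnit ((y : 𝓞_ℂ_[p]) : ℂ_[p])
    rw [hn]
    exact (pow_ne_zero _ hp0).isUnit
  · have h0 : Filter.Tendsto (fun n : ℕ => (p : ℝ)⁻¹ ^ n * ‖z‖) Filter.atTop (nhds (0 * ‖z‖)) :=
      (tendsto_pow_atTop_nhds_zero_of_lt_one (by positivity)
        (inv_lt_one_of_one_lt₀ (mod_cast hp.out.one_lt))).mul_const _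
    rw [zero_mul] at h0
    obtain ⟨n, hn⟩ := (h0.eventually (ge_mem_nhds one_pos)).exists
    refine ⟨⟨⟨z * (p : ℂ_[p]) ^ n, (mem_integers_iff p).2 ?_⟩, ⟨_, n, rfl⟩⟩, ?_⟩
    · rwa [norm_mul, norm_pow, norm_p, mul_comm]
    · change z * (((p : 𝓞_ℂ_[p]) ^ n : 𝓞_ℂ_[p]) : ℂ_[p]) = z * (p : ℂ_[p]) ^ n
      simp
  · rw [show x = y from Subtype.ext h]

lemma frobenius_surjective :
    Function.Surjective (frobenius (ModP 𝓞_ℂ_[p] p) p) := by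
  intro x
  obtain ⟨x, rfl⟩ := Ideal.Quotient.mk_surjective x
  obtain ⟨y, hy⟩ := IsAlgClosed.exists_pow_nat_eq (x : ℂ_[p]) hp.out.pos
  have hy1 : y ∈ 𝓞_ℂ_[p] := (mem_integers_iff p).2 <| by
    have := (mem_integers_iff p).1 x.2
    rw [← hy, norm_pow] at this
    exact (pow_le_one_iff_of_nonneg (norm_nonneg _) hp.out.ne_zero).1 this
  refine ⟨Ideal.Quotient.mk _ ⟨y, hy1⟩, ?_⟩
  rw [frobenius_def, ← map_pow]
  congr 1
  ext
  simpa using hy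

end IntegersOfCp

section Functoriality
variable {R : Type*} [CommRing R] {p : ℕ} [hp : Fact p.Prime] [Fact ¬IsUnit (p : R)]
  [IsAdicComplete (Ideal.span {(p : R)}) R]

lemma span_p_le_comap (p : ℕ) (σ : R ≃+* R) :
    Ideal.span {(p : R)} ≤ (Ideal.span {(p : R)}).comap (σ : R →+* R) := by
  rw [← Ideal.map_le_iff_le_comap, Ideal.map_span]
  simp

/-- The endomorphism of `R♭` induced by an automorphism of `R`. -/
def tiltMap (p : ℕ) [Fact p.Prime] [Fact ¬IsUnit (p : R)] (σ : R ≃+* R) :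
    PreTilt R p →+* PreTilt R p :=
  Perfection.map p (Ideal.quotientMap (Ideal.span {(p : R)}) (σ : R →+* R) (span_p_le_comap p σ))

lemma coeff_tiltMap (σ : R ≃+* R) (n : ℕ) (x : PreTilt R p) (y : R)
    (hy : Ideal.Quotient.mk _ y = PreTilt.coeff n x) :
    PreTilt.coeff n (tiltMap p σ x) = Ideal.Quotient.mk _ (σ y) := by
  change Ideal.quotientMap (Ideal.span {(p : R)}) (σ : R →+* R) (span_p_le_comap p σ)
    (PreTilt.coeff n x) = _
  rw [← hy]
  rfl

/-- If `x` and `y` are congruent modulo `p`, then `x ^ p ^ n` and `y ^ p ^ n` are congruent modulo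
`p ^ (n + 1)`. -/
lemma pow_congr {x y : R} (h : Ideal.Quotient.mk (Ideal.span {(p : R)}) x = Ideal.Quotient.mk _ y)
    (n : ℕ) : x ^ p ^ n - y ^ p ^ n ∈ Ideal.span {(p : R)} ^ (n + 1) := by
  rw [Ideal.span_singleton_pow, Ideal.mem_span_singleton]
  refine dvd_sub_pow_of_dvd_sub ?_ n
  rw [← Ideal.mem_span_singleton, ← Ideal.Quotient.mk_eq_mk_iff_sub_mem]
  exact h

/-- The untilt is the limit of `y ^ p ^ n`, for `y` a lift of the `n`-th coefficient. -/
lemma untilt_sub_pow_mem (x : PreTilt R p) (n : ℕ) (y : R)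
    (hy : Ideal.Quotient.mk _ y = PreTilt.coeff n x) :
    x.untilt - y ^ p ^ n ∈ Ideal.span {(p : R)} ^ (n + 1) := by
  rw [← PreTilt.untilt_iterate_frobeniusEquiv_symm_pow x n]
  apply pow_congr
  rw [PreTilt.mk_untilt_eq_coeff_zero, PreTilt.coeff_iterate_frobeniusEquiv_symm, hy, zero_add]

lemma eq_of_forall_sub_mem {x y : R} (h : ∀ n, x - y ∈ Ideal.span {(p : R)} ^ (n + 1)) :
    x = y := by
  rw [IsHausdorff.eq_iff_smodEq (I := Ideal.span {(p : R)})]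
  intro n
  rw [SModEq.sub_mem, smul_eq_mul, Ideal.mul_top]
  exact Ideal.pow_le_pow_right n.le_succ (h n)

lemma untilt_tiltMap (σ : R ≃+* R) (x : PreTilt R p) :
    (tiltMap p σ x).untilt = σ x.untilt := by
  apply eq_of_forall_sub_mem (p := p)
  intro n
  obtain ⟨y, hy⟩ := Ideal.Quotient.mk_surjective (PreTilt.coeff n x)
  have h1 := untilt_sub_pow_mem (tiltMap p σ x) n (σ y) (coeff_tiltMap σ n x y hy).symm
  have h2 := untilt_sub_pow_mem x n y hy
  have h3 : σ x.untilt - (σ y) ^ p ^ n ∈ Ideal.span {(p : R)} ^ (n + 1) := by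
    rw [Ideal.span_singleton_pow, Ideal.mem_span_singleton] at h2 ⊢
    simpa using map_dvd σ h2
  simpa using Ideal.sub_mem _ h1 h3

/-- The endomorphism of `W(R♭)` induced by an automorphism of `R`. -/
def ainfMap (p : ℕ) [Fact p.Prime] [Fact ¬IsUnit (p : R)] (σ : R ≃+* R) :
    WittVector p (PreTilt R p) →+* WittVector p (PreTilt R p) :=
  WittVector.map (tiltMap p σ)

lemma fontaineTheta_ainfMap (σ : R ≃+* R) (x : WittVector p (PreTilt R p)) :
    WittVector.fontaineTheta R p (ainfMap p σ x) = σ (WittVector.fontaineTheta R p x) := by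
  apply eq_of_forall_sub_mem (p := p)
  intro n
  rw [← Ideal.Quotient.mk_eq_mk_iff_sub_mem]
  refine RingHom.congr_fun (WittVector.eq_of_apply_teichmuller_eq
    ((Ideal.Quotient.mk (Ideal.span {(p : R)} ^ (n + 1))).comp
      ((WittVector.fontaineTheta R p).comp (ainfMap p σ)))
    ((Ideal.Quotient.mk (Ideal.span {(p : R)} ^ (n + 1))).comp
      ((σ : R →+* R).comp (WittVector.fontaineTheta R p))) ⟨n + 1, ?_⟩ fun y => ?_) x
  · rw [← map_natCast (Ideal.Quotient.mk (Ideal.span {(p : R)} ^ (n + 1))), ← map_pow,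
      Ideal.Quotient.eq_zero_iff_mem]
    exact Ideal.pow_mem_pow (Ideal.mem_span_singleton_self _) _
  · simp only [RingHom.comp_apply, ainfMap, WittVector.map_teichmuller,
      WittVector.fontaineTheta_teichmuller, untilt_tiltMap]
    rfl

variable (R p) in
/-- `A_inf[1/p]`, the ring whose completion along the kernel of `θ` is `B_dR⁺`. -/
abbrev AinfInvP : Type _ := Localization.Away (p : WittVector p (PreTilt R p))

variable (R p) in
/-- The kernel of `θ : A_inf[1/p] → R[1/p]`. -/
abbrev kerTheta : Ideal (AinfInvP R p) := RingHom.ker (fontaineThetaInvertP R p)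

lemma fontaineThetaInvertP_algebraMap (x : WittVector p (PreTilt R p)) :
    fontaineThetaInvertP R p (algebraMap _ _ x) =
      algebraMap _ _ (WittVector.fontaineTheta R p x) := by
  simp [fontaineThetaInvertP, Localization.awayLift]

/-- The endomorphism of `A_inf[1/p]` induced by an automorphism of `R`. -/
def ainfInvPMap (p : ℕ) [Fact p.Prime] [Fact ¬IsUnit (p : R)] (σ : R ≃+* R) :
    AinfInvP R p →+* AinfInvP R p :=
  Localization.awayLift ((algebraMap _ _).comp (ainfMap p σ)) _ (by
    simpa using IsLocalization.Away.algebraMap_isUnit (p : WittVector p (PreTilt R p)))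

lemma ainfInvPMap_algebraMap (σ : R ≃+* R) (x : WittVector p (PreTilt R p)) :
    ainfInvPMap p σ (algebraMap _ _ x) = algebraMap _ _ (ainfMap p σ x) := by
  simp [ainfInvPMap, Localization.awayLift]

variable (p) in
/-- The endomorphism of `R[1/p]` induced by an automorphism of `R`. -/
def invPMap (σ : R ≃+* R) : Localization.Away (p : R) →+* Localization.Away (p : R) :=
  Localization.awayLift ((algebraMap _ _).comp (σ : R →+* R)) _ (by
    simpa using IsLocalization.Away.algebraMap_isUnit (p : R))

lemma invPMap_algebraMap (σ : R ≃+* R) (x : R) :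
    invPMap p σ (algebraMap _ _ x) = algebraMap _ _ (σ x) := by
  simp [invPMap, Localization.awayLift]

lemma thetaInvP_ainfInvPMap (σ : R ≃+* R) (x : AinfInvP R p) :
    fontaineThetaInvertP R p (ainfInvPMap p σ x) = invPMap p σ (fontaineThetaInvertP R p x) := by
  refine RingHom.congr_fun (IsLocalization.ringHom_ext
    (Submonoid.powers (p : WittVector p (PreTilt R p)))
    (j := (fontaineThetaInvertP R p).comp (ainfInvPMap p σ))
    (k := (invPMap p σ).comp (fontaineThetaInvertP R p)) ?_) x
  ext y
  simp only [RingHom.comp_apply, ainfInvPMap_algebraMap, fontaineThetaInvertP_algebraMap,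
    invPMap_algebraMap, fontaineTheta_ainfMap]

lemma tiltMap_symm_apply (σ : R ≃+* R) (x : PreTilt R p) : tiltMap p σ (tiltMap p σ.symm x) = x := by
  refine Perfection.ext fun n => ?_
  obtain ⟨y, hy⟩ := Ideal.Quotient.mk_surjective (PreTilt.coeff n x)
  change PreTilt.coeff n _ = PreTilt.coeff n _
  rw [coeff_tiltMap σ n (tiltMap p σ.symm x) (σ.symm y) (coeff_tiltMap σ.symm n x y hy).symm,
    RingEquiv.apply_symm_apply, hy]

lemma ainfInvPMap_symm_apply (σ : R ≃+* R) (x : AinfInvP R p) :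
    ainfInvPMap p σ (ainfInvPMap p σ.symm x) = x := by
  refine RingHom.congr_fun (IsLocalization.ringHom_ext
    (Submonoid.powers (p : WittVector p (PreTilt R p)))
    (j := (ainfInvPMap p σ).comp (ainfInvPMap p σ.symm)) (k := RingHom.id _) ?_) x
  ext y
  simp only [RingHom.comp_apply, ainfInvPMap_algebraMap, RingHom.id_apply]
  congr 1
  ext n
  simp [ainfMap, tiltMap_symm_apply]

lemma ainfInvPMap_mem_kerTheta (σ : R ≃+* R) {x : AinfInvP R p} (hx : x ∈ kerTheta R p) :
    ainfInvPMap p σ x ∈ kerTheta R p := by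
  rw [RingHom.mem_ker] at hx ⊢
  rw [thetaInvP_ainfInvPMap, hx, map_zero]

lemma kerTheta_map (σ : R ≃+* R) : (kerTheta R p).map (ainfInvPMap p σ) = kerTheta R p := by
  apply le_antisymm
  · rw [Ideal.map_le_iff_le_comap]
    intro x hx
    rw [Ideal.mem_comap]
    exact ainfInvPMap_mem_kerTheta σ hx
  · intro x hx
    have h := Ideal.mem_map_of_mem (ainfInvPMap p σ) (ainfInvPMap_mem_kerTheta σ.symm hx)
    rwa [ainfInvPMap_symm_apply] at h

lemma kerTheta_pow_le_comap (σ : R ≃+* R) (n : ℕ) :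
    kerTheta R p ^ n ≤ (kerTheta R p ^ n).comap (ainfInvPMap p σ) := by
  rw [← Ideal.map_le_iff_le_comap, Ideal.map_pow, kerTheta_map]

variable (R p) in
/-- The projection `B_dR⁺ → A_inf[1/p] / (ker θ) ^ n`. -/
def evalPlus (n : ℕ) : BDeRhamPlus R p →+* AinfInvP R p ⧸ kerTheta R p ^ n :=
  (AdicCompletion.evalₐ (kerTheta R p) n).toRingHom

lemma evalPlus_ext {x y : BDeRhamPlus R p} (h : ∀ n, evalPlus R p n x = evalPlus R p n y) :
    x = y :=
  AdicCompletion.ext_evalₐ (I := kerTheta R p) h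

variable (R p) in
/-- The canonical map `A_inf[1/p] → B_dR⁺`. -/
def toPlus : AinfInvP R p →+* BDeRhamPlus R p :=
  algebraMap (AinfInvP R p) (AdicCompletion (kerTheta R p) (AinfInvP R p))

lemma evalPlus_toPlus (n : ℕ) (x : AinfInvP R p) :
    evalPlus R p n (toPlus R p x) = Ideal.Quotient.mk _ x :=
  AdicCompletion.evalₐ_of (kerTheta R p) n x

lemma factorPow_evalPlus {m n : ℕ} (h : m ≤ n) (x : BDeRhamPlus R p) :
    Ideal.Quotient.factorPow (kerTheta R p) h (evalPlus R p n x) = evalPlus R p m x := by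
  obtain ⟨r, rfl⟩ := AdicCompletion.mk_surjective (kerTheta R p) (AinfInvP R p) x
  have h1 : ∀ n, evalPlus R p n (AdicCompletion.mk (kerTheta R p) (AinfInvP R p) r) =
      Ideal.Quotient.mk _ (r.val n) := fun n => AdicCompletion.evalₐ_mk (kerTheta R p) n r
  rw [h1, h1]
  exact AdicCompletion.Ideal.mk_eq_mk (kerTheta R p) h r

lemma plusMap_compat (σ : R ≃+* R) {m n : ℕ} (h : m ≤ n) :
    (Ideal.Quotient.factorPow (kerTheta R p) h).comp
      ((Ideal.quotientMap _ (ainfInvPMap p σ) (kerTheta_pow_le_comap σ n)).comp (evalPlus R p n)) =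
    (Ideal.quotientMap _ (ainfInvPMap p σ) (kerTheta_pow_le_comap σ m)).comp (evalPlus R p m) := by
  ext x
  obtain ⟨y, hy⟩ := Ideal.Quotient.mk_surjective (evalPlus R p n x)
  simp only [RingHom.comp_apply]
  rw [← factorPow_evalPlus h, ← hy]
  rfl

/-- The endomorphism of `B_dR⁺` induced by an automorphism of `R`. -/
def plusMap (p : ℕ) [Fact p.Prime] [Fact ¬IsUnit (p : R)] [IsAdicComplete (Ideal.span {(p : R)}) R]
    (σ : R ≃+* R) : BDeRhamPlus R p →+* BDeRhamPlus R p :=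
  AdicCompletion.liftRingHom (kerTheta R p)
    (fun n => (Ideal.quotientMap _ (ainfInvPMap p σ) (kerTheta_pow_le_comap σ n)).comp
      (evalPlus R p n)) (plusMap_compat σ)

lemma evalPlus_plusMap (σ : R ≃+* R) (n : ℕ) (x : BDeRhamPlus R p) :
    evalPlus R p n (plusMap p σ x) =
      Ideal.quotientMap _ (ainfInvPMap p σ) (kerTheta_pow_le_comap σ n) (evalPlus R p n x) :=
  AdicCompletion.evalₐ_liftRingHom (kerTheta R p) _ (plusMap_compat σ) n x

lemma plusMap_toPlus (σ : R ≃+* R) (x : AinfInvP R p) :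
    plusMap p σ (toPlus R p x) = toPlus R p (ainfInvPMap p σ x) := by
  refine evalPlus_ext fun n => ?_
  rw [evalPlus_plusMap, evalPlus_toPlus, evalPlus_toPlus]
  rfl

variable (R p) in
/-- The multiplicative set inverted to pass from `B_dR⁺` to `B_dR`. -/
abbrev uniformizers : Submonoid (BDeRhamPlus R p) :=
  Submonoid.closure (AdicCompletion.of (kerTheta R p) _ '' {a | kerTheta R p = Ideal.span {a}})

instance : CommRing (BDeRham R p) :=
  inferInstanceAs (CommRing (Localization (uniformizers R p)))

instance : Algebra (BDeRhamPlus R p) (BDeRham R p) :=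
  inferInstanceAs (Algebra (BDeRhamPlus R p) (Localization (uniformizers R p)))

instance : IsLocalization (uniformizers R p) (BDeRham R p) :=
  inferInstanceAs (IsLocalization (uniformizers R p) (Localization (uniformizers R p)))

lemma uniformizers_le_comap (σ : R ≃+* R) :
    uniformizers R p ≤ (uniformizers R p).comap (plusMap p σ) := by
  rw [Submonoid.closure_le]
  rintro _ ⟨a, ha, rfl⟩
  refine Submonoid.subset_closure ⟨ainfInvPMap p σ a, ?_, (plusMap_toPlus σ a).symm⟩
  rw [Set.mem_ofPred_eq] at ha ⊢
  conv_lhs => rw [← kerTheta_map σ, ha, Ideal.map_span, Set.image_singleton]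

/-- The endomorphism of `B_dR` induced by an automorphism of `R`. -/
def bdrMap (p : ℕ) [Fact p.Prime] [Fact ¬IsUnit (p : R)] [IsAdicComplete (Ideal.span {(p : R)}) R]
    (σ : R ≃+* R) : BDeRham R p →+* BDeRham R p :=
  IsLocalization.map (M := uniformizers R p) (T := uniformizers R p) _ (plusMap p σ)
    (uniformizers_le_comap σ)

lemma bdrMap_algebraMap (σ : R ≃+* R) (x : BDeRhamPlus R p) :
    bdrMap p σ (algebraMap _ _ x) = algebraMap _ _ (plusMap p σ x) :=
  IsLocalization.map_eq _ x

end Functoriality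

section GaloisAction
variable (p : ℕ) [hp : Fact p.Prime]

variable {p} in
lemma continuous_gal (σ : Gal(PadicAlgCl p/ℚ_[p])) :
    Continuous (σ : PadicAlgCl p →+* PadicAlgCl p) := by
  refine (AddMonoidHomClass.isometry_of_norm (σ : PadicAlgCl p →+* PadicAlgCl p) fun x => ?_).continuous
  exact (spectralNorm_eq_of_equiv (K := ℚ_[p]) (L := PadicAlgCl p) σ x).symm

variable {p} in
/-- The extension of a Galois automorphism to a ring endomorphism of `ℂ_p` by continuity. -/
def galHom (σ : Gal(PadicAlgCl p/ℚ_[p])) : ℂ_[p] →+* ℂ_[p] :=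
  UniformSpace.Completion.mapRingHom (σ : PadicAlgCl p →+* PadicAlgCl p) (continuous_gal σ)

variable {p} in
lemma galHom_coe (σ : Gal(PadicAlgCl p/ℚ_[p])) (x : PadicAlgCl p) :
    galHom σ (x : ℂ_[p]) = ((σ x : PadicAlgCl p) : ℂ_[p]) :=
  UniformSpace.Completion.mapRingHom_coe (continuous_gal σ) x

variable {p} in
lemma continuous_galHom (σ : Gal(PadicAlgCl p/ℚ_[p])) : Continuous (galHom σ) :=
  UniformSpace.Completion.continuous_map

variable {p} in
lemma galHom_galHom (σ τ : Gal(PadicAlgCl p/ℚ_[p])) (h : σ * τ = 1) (x : ℂ_[p]) :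
    galHom σ (galHom τ x) = x := by
  induction x using UniformSpace.Completion.induction_on with
  | hp => exact isClosed_eq ((continuous_galHom σ).comp (continuous_galHom τ)) continuous_id
  | ih x =>
    rw [galHom_coe, galHom_coe, ← AlgEquiv.mul_apply, h, AlgEquiv.one_apply]

variable {p} in
lemma norm_galHom (σ : Gal(PadicAlgCl p/ℚ_[p])) (x : ℂ_[p]) : ‖galHom σ x‖ = ‖x‖ := by
  induction x using UniformSpace.Completion.induction_on with
  | hp => exact isClosed_eq (continuous_galHom σ).norm continuous_norm
  | ih x =>
    rw [galHom_coe, PadicComplex.norm_extends, PadicComplex.norm_extends]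
    exact (spectralNorm_eq_of_equiv (K := ℚ_[p]) (L := PadicAlgCl p) σ x).symm

variable {p} in
/-- The automorphism of `𝓞_ℂ_[p]` induced by a Galois automorphism. -/
def galInt (σ : Gal(PadicAlgCl p/ℚ_[p])) : 𝓞_ℂ_[p] ≃+* 𝓞_ℂ_[p] where
  toFun x := ⟨galHom σ x, (mem_integers_iff p).2 <| by
    rw [norm_galHom]; exact (mem_integers_iff p).1 x.2⟩
  invFun x := ⟨galHom σ⁻¹ x, (mem_integers_iff p).2 <| by
    rw [norm_galHom]; exact (mem_integers_iff p).1 x.2⟩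
  left_inv x := Subtype.ext (galHom_galHom _ _ (inv_mul_cancel σ) _)
  right_inv x := Subtype.ext (galHom_galHom _ _ (mul_inv_cancel σ) _)
  map_mul' x y := Subtype.ext (map_mul (galHom σ) _ _)
  map_add' x y := Subtype.ext (map_add (galHom σ) _ _)

/-- The ring `B_dR⁺` of `ℂ_p`. -/
abbrev BdRPlus : Type := BDeRhamPlus 𝓞_ℂ_[p] p

/-- The field of `p`-adic periods `B_dR`. -/
abbrev BdR : Type := BDeRham 𝓞_ℂ_[p] p

variable {p} in
/-- The action of the Galois group of `ℚ_p` on `B_dR`. -/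
def galBdR (σ : Gal(PadicAlgCl p/ℚ_[p])) : BdR p →+* BdR p := bdrMap p (galInt σ)

/-- The map `ℤ_p = W(𝔽_p) → W(𝓞_ℂ_[p]♭)`. -/
def zpToAinf : ℤ_[p] →+* WittVector p (PreTilt 𝓞_ℂ_[p] p) :=
  (WittVector.map (ZMod.castHom dvd_rfl (PreTilt 𝓞_ℂ_[p] p))).comp
    (WittVector.equiv p).symm.toRingHom

lemma isUnit_zpToAinf (y : nonZeroDivisors ℤ_[p]) :
    IsUnit (((algebraMap _ (AinfInvP 𝓞_ℂ_[p] p)).comp (zpToAinf p)) y) := by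
  have hy : (y : ℤ_[p]) ≠ 0 := nonZeroDivisors.coe_ne_zero y
  rw [PadicInt.unitCoeff_spec hy, map_mul, map_pow]
  refine IsUnit.mul (RingHom.isUnit_map _ (Units.isUnit _)) (IsUnit.pow _ ?_)
  have h := IsLocalization.Away.algebraMap_isUnit (S := AinfInvP 𝓞_ℂ_[p] p)
    (p : WittVector p (PreTilt 𝓞_ℂ_[p] p))
  simpa using h

/-- The `ℚ_p`-algebra structure of `A_inf[1/p]`, coming from `ℤ_p = W(𝔽_p) → A_inf`. -/
instance : Algebra ℚ_[p] (AinfInvP 𝓞_ℂ_[p] p) :=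
  (IsLocalization.lift (M := nonZeroDivisors ℤ_[p]) (isUnit_zpToAinf p)).toAlgebra

lemma algebraMap_coe_zp (x : ℤ_[p]) :
    algebraMap ℚ_[p] (AinfInvP 𝓞_ℂ_[p] p) x = algebraMap _ _ (zpToAinf p x) :=
  IsLocalization.lift_eq (M := nonZeroDivisors ℤ_[p]) (isUnit_zpToAinf p) x

/-- Two ring homomorphisms on `ℚ_p` that agree on `ℤ_p` are equal. -/
lemma qp_ringHom_ext {S : Type*} [CommRing S] {f g : ℚ_[p] →+* S}
    (h : ∀ x : ℤ_[p], f x = g x) : f = g :=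
  IsLocalization.ringHom_ext (nonZeroDivisors ℤ_[p]) (RingHom.ext h)

/-- There is only one ring homomorphism `ℤ_p → 𝓞_ℂ_[p]`. -/
lemma zp_ringHom_unique (f g : ℤ_[p] →+* 𝓞_ℂ_[p]) : f = g := by
  ext1 x
  apply eq_of_forall_sub_mem (p := p)
  intro n
  have h := PadicInt.appr_spec (n + 1) x
  have key : ∀ k : ℤ_[p] →+* 𝓞_ℂ_[p], k x - (x.appr (n + 1) : 𝓞_ℂ_[p]) ∈
      Ideal.span {(p : 𝓞_ℂ_[p])} ^ (n + 1) := by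
    intro k
    rw [Ideal.mem_span_singleton] at h
    rw [Ideal.span_singleton_pow, Ideal.mem_span_singleton]
    simpa using map_dvd k h
  simpa using Ideal.sub_mem _ (key f) (key g)

/-- `θ : A_inf[1/p] → ℂ_p`. -/
def thetaCp : AinfInvP 𝓞_ℂ_[p] p →+* ℂ_[p] :=
  (IsLocalization.algEquiv (Submonoid.powers (p : 𝓞_ℂ_[p])) (Localization.Away (p : 𝓞_ℂ_[p]))
    ℂ_[p]).toRingHom.comp (fontaineThetaInvertP 𝓞_ℂ_[p] p)

lemma thetaCp_algebraMap (x : WittVector p (PreTilt 𝓞_ℂ_[p] p)) :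
    thetaCp p (algebraMap _ _ x) = (WittVector.fontaineTheta 𝓞_ℂ_[p] p x : ℂ_[p]) := by
  change IsLocalization.algEquiv (Submonoid.powers (p : 𝓞_ℂ_[p]))
    (Localization.Away (p : 𝓞_ℂ_[p])) ℂ_[p] (fontaineThetaInvertP 𝓞_ℂ_[p] p (algebraMap _ _ x)) = _
  rw [fontaineThetaInvertP_algebraMap, AlgEquiv.commutes]
  rfl

lemma ker_thetaCp : RingHom.ker (thetaCp p) = kerTheta 𝓞_ℂ_[p] p := by
  ext x
  exact (map_eq_zero_iff _ (IsLocalization.algEquiv (Submonoid.powers (p : 𝓞_ℂ_[p]))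
    (Localization.Away (p : 𝓞_ℂ_[p])) ℂ_[p]).injective)

lemma thetaCp_surjective : Function.Surjective (thetaCp p) := by
  intro z
  obtain ⟨n, a, hz⟩ := IsLocalization.Away.surj (p : 𝓞_ℂ_[p]) z
  obtain ⟨w, rfl⟩ := surjective_fontaineTheta (frobenius_surjective p) a
  have hu := IsLocalization.Away.algebraMap_isUnit (S := AinfInvP 𝓞_ℂ_[p] p)
    (p : WittVector p (PreTilt 𝓞_ℂ_[p] p))
  obtain ⟨u, hu⟩ := hu
  have hp0 : (p : ℂ_[p]) ≠ 0 := by exact_mod_cast hp.out.ne_zero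
  refine ⟨algebraMap _ _ w * ((u⁻¹ : (AinfInvP 𝓞_ℂ_[p] p)ˣ) : AinfInvP 𝓞_ℂ_[p] p) ^ n, ?_⟩
  have h1 : thetaCp p ((u⁻¹ : (AinfInvP 𝓞_ℂ_[p] p)ˣ) : AinfInvP 𝓞_ℂ_[p] p) * (p : ℂ_[p]) = 1 := by
    have := congrArg (thetaCp p) u.inv_mul
    rwa [hu, map_mul, map_one, map_natCast, map_natCast] at this
  have h2 : z * (p : ℂ_[p]) ^ n = thetaCp p (algebraMap _ _ w) := by
    rw [thetaCp_algebraMap]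
    simpa using hz
  rw [map_mul, map_pow, ← h2, mul_assoc, ← mul_pow, mul_comm (p : ℂ_[p]), h1, one_pow, mul_one]

/-- `θ` as a homomorphism of `ℚ_p`-algebras. -/
def thetaCpAlg : AinfInvP 𝓞_ℂ_[p] p →ₐ[ℚ_[p]] ℂ_[p] where
  __ := thetaCp p
  commutes' := RingHom.congr_fun <| qp_ringHom_ext p (f := (thetaCp p).comp (algebraMap ℚ_[p] _))
    (g := algebraMap ℚ_[p] ℂ_[p]) fun x => by
      have hmem : ∀ x : ℤ_[p], algebraMap ℚ_[p] ℂ_[p] x ∈ (𝓞_ℂ_[p]).toSubring := fun x =>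
        (mem_integers_iff p).2 <| by
          rw [norm_algebraMap']
          exact x.norm_le_one
      rw [RingHom.comp_apply, algebraMap_coe_zp, thetaCp_algebraMap]
      exact congrArg Subtype.val (RingHom.congr_fun (zp_ringHom_unique p
        ((WittVector.fontaineTheta 𝓞_ℂ_[p] p).comp (zpToAinf p))
        (((algebraMap ℚ_[p] ℂ_[p]).comp PadicInt.Coe.ringHom).codRestrict (𝓞_ℂ_[p]).toSubring
          hmem)) x)

variable {p} in
lemma thetaCp_ainfInvPMap (σ : Gal(PadicAlgCl p/ℚ_[p])) (x : AinfInvP 𝓞_ℂ_[p] p) :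
    thetaCp p (ainfInvPMap p (galInt σ) x) = galHom σ (thetaCp p x) := by
  refine RingHom.congr_fun (IsLocalization.ringHom_ext
    (Submonoid.powers (p : WittVector p (PreTilt 𝓞_ℂ_[p] p)))
    (j := (thetaCp p).comp (ainfInvPMap p (galInt σ)))
    (k := (galHom σ).comp (thetaCp p)) ?_) x
  ext y
  simp only [RingHom.comp_apply, ainfInvPMap_algebraMap, thetaCp_algebraMap, fontaineTheta_ainfMap]
  rfl

variable {p} in
lemma ainfInvPMap_algebraMap_qp (σ : Gal(PadicAlgCl p/ℚ_[p])) (x : ℚ_[p]) :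
    ainfInvPMap p (galInt σ) (algebraMap ℚ_[p] _ x) = algebraMap ℚ_[p] _ x := by
  refine RingHom.congr_fun (qp_ringHom_ext p
    (f := (ainfInvPMap p (galInt σ)).comp (algebraMap ℚ_[p] _)) (g := algebraMap ℚ_[p] _)
    fun x => ?_) x
  rw [RingHom.comp_apply, algebraMap_coe_zp, ainfInvPMap_algebraMap]
  congr 1
  ext n
  change tiltMap p (galInt σ) (ZMod.castHom dvd_rfl _ _) = ZMod.castHom dvd_rfl _ _
  rw [← RingHom.comp_apply]
  congr 1
  exact Subsingleton.elim _ _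

lemma kerTheta_pow_le (n : ℕ) (x : AinfInvP 𝓞_ℂ_[p] p) (hx : x ∈ kerTheta 𝓞_ℂ_[p] p ^ (n + 1)) :
    thetaCpAlg p x = 0 := by
  have h : x ∈ RingHom.ker (thetaCp p) := by
    rw [ker_thetaCp]
    exact Ideal.pow_le_self n.succ_ne_zero hx
  exact h

/-- `θ` modulo a power of its kernel. -/
def thetaQuot (n : ℕ) : (AinfInvP 𝓞_ℂ_[p] p ⧸ kerTheta 𝓞_ℂ_[p] p ^ (n + 1)) →ₐ[ℚ_[p]] ℂ_[p] :=
  Ideal.Quotient.liftₐ _ (thetaCpAlg p) (kerTheta_pow_le p n)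

lemma thetaQuot_mk (n : ℕ) (x : AinfInvP 𝓞_ℂ_[p] p) :
    thetaQuot p n (Ideal.Quotient.mk _ x) = thetaCp p x := rfl

lemma thetaQuot_surjective (n : ℕ) : Function.Surjective (thetaQuot p n) := fun z => by
  obtain ⟨x, rfl⟩ := thetaCp_surjective p z
  exact ⟨Ideal.Quotient.mk _ x, rfl⟩

lemma isNilpotent_ker_thetaQuot (n : ℕ) :
    IsNilpotent (RingHom.ker ((thetaQuot p n).toRingHom)) := by
  refine ⟨n + 1, ?_⟩
  have h : RingHom.ker ((thetaQuot p n).toRingHom) ≤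
      (kerTheta 𝓞_ℂ_[p] p).map (Ideal.Quotient.mk (kerTheta 𝓞_ℂ_[p] p ^ (n + 1))) := by
    intro y hy
    obtain ⟨x, rfl⟩ := Ideal.Quotient.mk_surjective y
    refine Ideal.mem_map_of_mem _ ?_
    rw [← ker_thetaCp]
    exact hy
  rw [Ideal.zero_eq_bot, eq_bot_iff]
  refine (Ideal.pow_right_mono h (n + 1)).trans ?_
  rw [← Ideal.map_pow, Ideal.map_quotient_self]

instance : Algebra.FormallyEtale ℚ_[p] (PadicAlgCl p) := Algebra.FormallyEtale.of_isSeparable _ _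

/-- The embedding `ℚ̄_p ⊆ ℂ_p`. -/
def algClToCp : PadicAlgCl p →ₐ[ℚ_[p]] ℂ_[p] := IsScalarTower.toAlgHom _ _ _

/-- The unique lift of `ℚ̄_p → ℂ_p` along `θ` modulo a power of the kernel of `θ`. -/
def liftQuot (n : ℕ) :
    PadicAlgCl p →ₐ[ℚ_[p]] (AinfInvP 𝓞_ℂ_[p] p ⧸ kerTheta 𝓞_ℂ_[p] p ^ (n + 1)) :=
  Algebra.FormallySmooth.liftOfSurjective (algClToCp p) (thetaQuot p n) (thetaQuot_surjective p n)
    (isNilpotent_ker_thetaQuot p n)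

lemma thetaQuot_liftQuot (n : ℕ) (x : PadicAlgCl p) :
    thetaQuot p n (liftQuot p n x) = algClToCp p x :=
  Algebra.FormallySmooth.liftOfSurjective_apply _ _ _ _ x

lemma algHom_quot_ext (n : ℕ)
    {f g : PadicAlgCl p →ₐ[ℚ_[p]] (AinfInvP 𝓞_ℂ_[p] p ⧸ kerTheta 𝓞_ℂ_[p] p ^ (n + 1))}
    (h : ∀ x, thetaQuot p n (f x) = thetaQuot p n (g x)) : f = g :=
  Algebra.FormallyUnramified.ext' ((thetaQuot p n).toRingHom) (isNilpotent_ker_thetaQuot p n) f g h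

lemma thetaQuot_factor {m n : ℕ} (h : m ≤ n)
    (x : AinfInvP 𝓞_ℂ_[p] p ⧸ kerTheta 𝓞_ℂ_[p] p ^ (n + 1)) :
    thetaQuot p m (Ideal.Quotient.factorₐ ℚ_[p]
      (Ideal.pow_le_pow_right (Nat.succ_le_succ h)) x) = thetaQuot p n x := by
  obtain ⟨x, rfl⟩ := Ideal.Quotient.mk_surjective x
  rfl

lemma factor_liftQuot {m n : ℕ} (h : m ≤ n) :
    (Ideal.Quotient.factorₐ ℚ_[p] (Ideal.pow_le_pow_right (Nat.succ_le_succ h))).comp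
      (liftQuot p n) = liftQuot p m := by
  refine algHom_quot_ext p m fun x => ?_
  rw [AlgHom.comp_apply, thetaQuot_factor p h, thetaQuot_liftQuot, thetaQuot_liftQuot]

lemma liftQuot_compat {m n : ℕ} (h : m ≤ n) :
    (Ideal.Quotient.factorₐ ℚ_[p] (Ideal.pow_le_pow_right h)).comp
      ((Ideal.Quotient.factorₐ ℚ_[p] (Ideal.pow_le_pow_right n.le_succ)).comp (liftQuot p n)) =
    (Ideal.Quotient.factorₐ ℚ_[p] (Ideal.pow_le_pow_right m.le_succ)).comp (liftQuot p m) := by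
  rw [← factor_liftQuot p h]
  ext x
  obtain ⟨y, hy⟩ := Ideal.Quotient.mk_surjective (liftQuot p n x)
  simp only [AlgHom.comp_apply]
  rw [← hy]
  rfl

/-- The canonical embedding `ℚ̄_p → B_dR⁺`: the unique homomorphism of `ℚ_p`-algebras that lifts
the inclusion `ℚ̄_p ⊆ ℂ_p` along `θ`. -/
def algClToPlus : PadicAlgCl p →+* BdRPlus p :=
  (AdicCompletion.liftAlgHom (kerTheta 𝓞_ℂ_[p] p)
    (fun n => (Ideal.Quotient.factorₐ ℚ_[p] (Ideal.pow_le_pow_right n.le_succ)).comp (liftQuot p n))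
    (liftQuot_compat p)).toRingHom

lemma evalPlus_algClToPlus (n : ℕ) (x : PadicAlgCl p) :
    evalPlus 𝓞_ℂ_[p] p (n + 1) (algClToPlus p x) = liftQuot p n x := by
  refine (AdicCompletion.evalₐ_liftAlgHom (kerTheta 𝓞_ℂ_[p] p) _ (liftQuot_compat p) (n + 1) x).trans ?_
  exact AlgHom.congr_fun (factor_liftQuot p n.le_succ) x

/-- `θ : B_dR⁺ → ℂ_p`. -/
def thetaPlus : BdRPlus p →+* ℂ_[p] :=
  (thetaQuot p 0 : _ →+* ℂ_[p]).comp (evalPlus 𝓞_ℂ_[p] p 1)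

lemma thetaPlus_eq (n : ℕ) (x : BdRPlus p) :
    thetaPlus p x = thetaQuot p n (evalPlus 𝓞_ℂ_[p] p (n + 1) x) := by
  rw [← thetaQuot_factor p n.zero_le]
  change thetaQuot p 0 _ = _
  rw [← factorPow_evalPlus (Nat.succ_le_succ n.zero_le) x]
  rfl

lemma thetaPlus_algClToPlus (x : PadicAlgCl p) : thetaPlus p (algClToPlus p x) = (x : ℂ_[p]) := by
  rw [thetaPlus_eq p 0, evalPlus_algClToPlus, thetaQuot_liftQuot]
  rfl

lemma algClToPlus_algebraMap (x : ℚ_[p]) :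
    algClToPlus p (algebraMap _ _ x) = toPlus _ p (algebraMap ℚ_[p] (AinfInvP 𝓞_ℂ_[p] p) x) :=
  AlgHom.commutes (AdicCompletion.liftAlgHom (kerTheta 𝓞_ℂ_[p] p)
    (fun n => (Ideal.Quotient.factorₐ ℚ_[p] (Ideal.pow_le_pow_right n.le_succ)).comp (liftQuot p n))
    (liftQuot_compat p)) x

lemma algClToPlus_unique {f : PadicAlgCl p →+* BdRPlus p}
    (hf : ∀ x : ℚ_[p], f (algebraMap _ _ x) = toPlus _ p (algebraMap _ _ x))
    (hθ : ∀ x, thetaPlus p (f x) = (x : ℂ_[p])) : f = algClToPlus p := by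
  ext1 x
  refine evalPlus_ext fun n => ?_
  let F : PadicAlgCl p →ₐ[ℚ_[p]] (AinfInvP 𝓞_ℂ_[p] p ⧸ kerTheta 𝓞_ℂ_[p] p ^ (n + 1)) :=
    { (evalPlus 𝓞_ℂ_[p] p (n + 1)).comp f with
      commutes' := fun x => by
        change evalPlus 𝓞_ℂ_[p] p (n + 1) (f _) = _
        rw [hf, evalPlus_toPlus]
        rfl }
  have hF : F = liftQuot p n := algHom_quot_ext p n fun x => by
    rw [thetaQuot_liftQuot]
    change thetaQuot p n (evalPlus 𝓞_ℂ_[p] p (n + 1) (f x)) = _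
    rw [← thetaPlus_eq, hθ]
    rfl
  rw [← factorPow_evalPlus n.le_succ, ← factorPow_evalPlus n.le_succ (algClToPlus p x),
    evalPlus_algClToPlus]
  exact congrArg _ (AlgHom.congr_fun hF x)

variable {p} in
lemma thetaPlus_plusMap (σ : Gal(PadicAlgCl p/ℚ_[p])) (x : BdRPlus p) :
    thetaPlus p (plusMap p (galInt σ) x) = galHom σ (thetaPlus p x) := by
  rw [thetaPlus_eq p 0, thetaPlus_eq p 0, evalPlus_plusMap]
  obtain ⟨y, hy⟩ := Ideal.Quotient.mk_surjective (evalPlus 𝓞_ℂ_[p] p (0 + 1) x)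
  rw [← hy, Ideal.quotientMap_mk, thetaQuot_mk, thetaQuot_mk, thetaCp_ainfInvPMap]

variable {p} in
lemma plusMap_algClToPlus (σ : Gal(PadicAlgCl p/ℚ_[p])) (x : PadicAlgCl p) :
    plusMap p (galInt σ) (algClToPlus p x) = algClToPlus p (σ x) := by
  have h := algClToPlus_unique p (f := ((plusMap p (galInt σ)).comp (algClToPlus p)).comp
    ((σ⁻¹ : Gal(PadicAlgCl p/ℚ_[p])) : PadicAlgCl p →+* PadicAlgCl p)) (fun x => by
      simp only [RingHom.comp_apply, RingHom.coe_coe, AlgEquiv.commutes]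
      rw [algClToPlus_algebraMap, plusMap_toPlus, ainfInvPMap_algebraMap_qp]) (fun x => by
      simp only [RingHom.comp_apply, RingHom.coe_coe]
      rw [thetaPlus_plusMap, thetaPlus_algClToPlus, galHom_coe, ← AlgEquiv.mul_apply,
        mul_inv_cancel, AlgEquiv.one_apply])
  have h2 := RingHom.congr_fun h (σ x)
  simp only [RingHom.comp_apply, RingHom.coe_coe] at h2
  rwa [← AlgEquiv.mul_apply, inv_mul_cancel, AlgEquiv.one_apply] at h2

/-- The canonical `ℚ̄_p`-algebra structure on `B_dR`. -/
instance : Algebra (PadicAlgCl p) (BdR p) :=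
  ((algebraMap (BdRPlus p) (BdR p)).comp (algClToPlus p)).toAlgebra

instance : Algebra ℚ_[p] (BdR p) :=
  ((algebraMap (PadicAlgCl p) (BdR p)).comp (algebraMap ℚ_[p] (PadicAlgCl p))).toAlgebra

instance : IsScalarTower ℚ_[p] (PadicAlgCl p) (BdR p) := IsScalarTower.of_algebraMap_eq fun _ => rfl

variable {p} in
lemma galBdR_algebraMap (σ : Gal(PadicAlgCl p/ℚ_[p])) (x : PadicAlgCl p) :
    galBdR σ (algebraMap _ (BdR p) x) = algebraMap _ (BdR p) (σ x) := by
  change bdrMap p (galInt σ) (algebraMap (BdRPlus p) (BdR p) (algClToPlus p x)) = _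
  rw [bdrMap_algebraMap, plusMap_algClToPlus]
  rfl

variable {p} in
/-- The action of the Galois group on `B_dR`, as a `ℚ_p`-linear map. -/
def galBdRLin (σ : Gal(PadicAlgCl p/ℚ_[p])) : BdR p →ₐ[ℚ_[p]] BdR p where
  __ := galBdR σ
  commutes' x := by
    change galBdR σ (algebraMap (PadicAlgCl p) (BdR p) (algebraMap ℚ_[p] (PadicAlgCl p) x)) = _
    rw [galBdR_algebraMap, AlgEquiv.commutes]
    rfl

end GaloisAction

section Period
variable {p : ℕ} [hp : Fact p.Prime]

/-- A non-trivial compatible system of `p`-power roots of unity in `ℚ̄_p`. -/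
structure CompatibleRoots (p : ℕ) [Fact p.Prime] where
  /-- The roots of unity. -/
  root : ℕ → PadicAlgCl p
  root_zero : root 0 = 1
  root_one_ne : root 1 ≠ 1
  root_succ_pow : ∀ n, root (n + 1) ^ p = root n

namespace CompatibleRoots
variable (z : CompatibleRoots p)

lemma root_pow (n : ℕ) : z.root n ^ p ^ n = 1 := by
  induction n with
  | zero => simp [z.root_zero]
  | succ n ih => rw [pow_succ', pow_mul, z.root_succ_pow, ih]

/-- The roots of unity as elements of `𝓞_ℂ_[p]`. -/
def rootInt (n : ℕ) : 𝓞_ℂ_[p] :=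
  ⟨(z.root n : ℂ_[p]), (mem_integers_iff p).2 <| by
    have h : ‖z.root n‖ ^ p ^ n = 1 := by rw [← norm_pow, z.root_pow, norm_one]
    rw [PadicComplex.norm_extends]
    exact ((pow_eq_one_iff_of_nonneg (norm_nonneg _) (pow_ne_zero _ hp.out.ne_zero)).1 h).le⟩

lemma rootInt_succ_pow (n : ℕ) : z.rootInt (n + 1) ^ p = z.rootInt n := by
  ext
  change ((z.root (n + 1) : ℂ_[p])) ^ p = (z.root n : ℂ_[p])
  rw [← z.root_succ_pow n, PadicComplex.coe_eq, PadicComplex.coe_eq, map_pow]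

lemma rootInt_pow (n : ℕ) : z.rootInt n ^ p ^ n = 1 := by
  ext
  change ((z.root n : ℂ_[p])) ^ p ^ n = 1
  rw [PadicComplex.coe_eq, ← map_pow, z.root_pow, map_one]

/-- The element `ε = (ζ_0, ζ_1, ζ_2, …)` of `𝓞_ℂ_[p]♭`. -/
def eps : PreTilt 𝓞_ℂ_[p] p :=
  ⟨fun n => Ideal.Quotient.mk _ (z.rootInt n), fun n => by
    rw [← map_pow, z.rootInt_succ_pow]⟩

lemma untilt_eps : z.eps.untilt = 1 := by
  apply eq_of_forall_sub_mem (p := p)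
  intro n
  have h := untilt_sub_pow_mem z.eps n (z.rootInt n) rfl
  rwa [z.rootInt_pow] at h

/-- The element `[ε] - 1` of `A_inf[1/p]`. -/
def epsSubOne : AinfInvP 𝓞_ℂ_[p] p := algebraMap _ _ (WittVector.teichmuller p z.eps) - 1

lemma epsSubOne_mem : z.epsSubOne ∈ kerTheta 𝓞_ℂ_[p] p := by
  rw [RingHom.mem_ker, epsSubOne, map_sub, fontaineThetaInvertP_algebraMap,
    WittVector.fontaineTheta_teichmuller, untilt_eps, map_one, map_one, sub_self]

/-- The partial sums of `log [ε] = ∑_{i ≥ 0} (-1) ^ i ([ε] - 1) ^ (i + 1) / (i + 1)`. -/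
def logPartialSum (n : ℕ) : AinfInvP 𝓞_ℂ_[p] p :=
  ∑ i ∈ Finset.range n, algebraMap ℚ_[p] _ ((-1) ^ i / (i + 1)) * z.epsSubOne ^ (i + 1)

lemma logPartialSum_succ (n : ℕ) : z.logPartialSum n ≡ z.logPartialSum (n + 1)
    [SMOD (kerTheta 𝓞_ℂ_[p] p ^ n • ⊤ : Submodule (AinfInvP 𝓞_ℂ_[p] p) (AinfInvP 𝓞_ℂ_[p] p))] := by
  rw [SModEq.sub_mem, smul_eq_mul, Ideal.mul_top, logPartialSum, logPartialSum,
    Finset.sum_range_succ, sub_add_cancel_left]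
  refine neg_mem (Ideal.mul_mem_left _ _ ?_)
  exact Ideal.pow_le_pow_right n.le_succ (Ideal.pow_mem_pow z.epsSubOne_mem _)

/-- The `p`-adic period `t = log [ε] ∈ B_dR⁺`. -/
def tPlus : BdRPlus p :=
  AdicCompletion.mk (kerTheta 𝓞_ℂ_[p] p) (AinfInvP 𝓞_ℂ_[p] p)
    (AdicCompletion.AdicCauchySequence.mk _ _ z.logPartialSum z.logPartialSum_succ)

/-- The `p`-adic period `t = log [ε]` as an element of `B_dR`. -/
def t : BdR p := algebraMap (BdRPlus p) (BdR p) z.tPlus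

/-- The integral powers `t ^ a` of the period `t` in the field `B_dR`. -/
def tPow (a : ℤ) : BdR p := if 0 ≤ a then z.t ^ a.toNat else Ring.inverse z.t ^ (-a).toNat

end CompatibleRoots
end Period

section Representations
variable {p : ℕ} [hp : Fact p.Prime]

/-- The `p`-adic cyclotomic character of `G_{K_v}`. -/
def cyclo (Kv : IntermediateField ℚ_[p] (PadicAlgCl p)) :
    Gal(PadicAlgCl p/Kv) →* ℚ_[p]ˣ :=
  (Units.map (PadicInt.Coe.ringHom (p := p) : ℤ_[p] →* ℚ_[p])).comp
    ((cyclotomicCharacter (PadicAlgCl p) p).comp (MulSemiringAction.toRingAut _ _))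

/-- The Tate twist `ℚ_p(n)`. -/
def tateTwist (Kv : IntermediateField ℚ_[p] (PadicAlgCl p)) (n : ℤ) :
    Representation ℚ_[p] Gal(PadicAlgCl p/Kv) ℚ_[p] where
  toFun g := ((cyclo Kv g ^ n : ℚ_[p]ˣ) : ℚ_[p]) • LinearMap.id
  map_one' := by simp [Module.End.one_eq_id]
  map_mul' g h := by
    ext
    simp [mul_zpow, mul_comm]

variable {Kv : IntermediateField ℚ_[p] (PadicAlgCl p)}
  {V : Type*} [AddCommGroup V] [Module ℚ_[p] V]

/-- A representation of `G_{K_v}` on a finite-dimensional `ℚ_p`-vector space is continuous if its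
matrix coefficients are continuous for the Krull topology. -/
def IsContinuousRep (ρ : Representation ℚ_[p] Gal(PadicAlgCl p/Kv) V) : Prop :=
  ∀ (v : V) (f : Module.Dual ℚ_[p] V), Continuous fun g => f (ρ g v)

/-- The diagonal action of `G_{K_v}` on `B_dR ⊗ V`. -/
def galTensor (ρ : Representation ℚ_[p] Gal(PadicAlgCl p/Kv) V) (g : Gal(PadicAlgCl p/Kv)) :
    BdR p ⊗[ℚ_[p]] V →ₗ[ℚ_[p]] BdR p ⊗[ℚ_[p]] V :=
  TensorProduct.map (galBdRLin (g.restrictScalars ℚ_[p])).toLinearMap (ρ g)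

lemma galTensor_smul (ρ : Representation ℚ_[p] Gal(PadicAlgCl p/Kv) V) (g : Gal(PadicAlgCl p/Kv))
    (c : Kv) (x : BdR p ⊗[ℚ_[p]] V) : galTensor ρ g (c • x) = c • galTensor ρ g x := by
  induction x with
  | zero => simp
  | add x y hx hy => rw [smul_add, map_add, hx, hy, map_add, smul_add]
  | tmul b v =>
    change (galBdR (g.restrictScalars ℚ_[p]) (c • b)) ⊗ₜ[ℚ_[p]] ρ g v =
      (c • (galBdR (g.restrictScalars ℚ_[p]) b)) ⊗ₜ[ℚ_[p]] ρ g v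
    rw [Algebra.smul_def, Algebra.smul_def, map_mul]
    congr 2
    change galBdR (g.restrictScalars ℚ_[p]) (algebraMap (PadicAlgCl p) (BdR p) c) =
      algebraMap (PadicAlgCl p) (BdR p) c
    rw [galBdR_algebraMap]
    congr 1
    exact g.commutes c

/-- `D_dR(V) = (B_dR ⊗ V) ^ {G_{K_v}}`, a vector space over `K_v`. -/
def DdR (ρ : Representation ℚ_[p] Gal(PadicAlgCl p/Kv) V) :
    Submodule Kv (BdR p ⊗[ℚ_[p]] V) where
  carrier := {x | ∀ g, galTensor ρ g x = x}
  zero_mem' g := map_zero _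
  add_mem' hx hy g := by rw [map_add, hx g, hy g]
  smul_mem' c x hx g := by rw [galTensor_smul, hx g]

/-- `V` is `B_dR`-admissible if the comparison map `B_dR ⊗_{K_v} D_dR(V) → B_dR ⊗_{ℚ_p} V` is
an isomorphism. -/
def IsBdRAdmissible (ρ : Representation ℚ_[p] Gal(PadicAlgCl p/Kv) V) : Prop :=
  IsBaseChange (BdR p) (DdR ρ).subtype

/-- The de Rham realization `D_dR(V) → D_dR(V)` of a `G_{K_v}`-equivariant endomorphism of `V`. -/
def deRhamRealization (ρ : Representation ℚ_[p] Gal(PadicAlgCl p/Kv) V) (τ : Module.End ℚ_[p] V)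
    (hτ : ∀ g, τ ∘ₗ ρ g = ρ g ∘ₗ τ) : DdR ρ →ₗ[Kv] DdR ρ :=
  ((τ.baseChange (BdR p)).restrictScalars Kv).restrict fun x hx g => by
    have key : ∀ y : BdR p ⊗[ℚ_[p]] V, galTensor ρ g (τ.baseChange (BdR p) y) =
        τ.baseChange (BdR p) (galTensor ρ g y) := by
      intro y
      induction y with
      | zero => simp
      | add x y hx hy => simp only [map_add, hx, hy]
      | tmul b v =>
        simp only [LinearMap.baseChange_tmul, galTensor, TensorProduct.map_tmul]
        congr 1
        exact (LinearMap.congr_fun (hτ g) v).symm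
    exact (key x).trans (congrArg _ (hx g))

/-- The `B_dR`-linear functional `φ_{B_dR}` on `B_dR ⊗ V` defined by a functional
`φ : V → ℚ_p(a)`: extend scalars and embed `ℚ_p(a)` into `B_dR` by sending the standard
generator to `t ^ a`. -/
def bdRFunctional (z : CompatibleRoots p) (a : ℤ) (φ : V →ₗ[ℚ_[p]] ℚ_[p]) :
    BdR p ⊗[ℚ_[p]] V →ₗ[BdR p] BdR p :=
  z.tPow a • ((TensorProduct.AlgebraTensorModule.rid ℚ_[p] (BdR p) (BdR p)).toLinearMap ∘ₗ
    φ.baseChange (BdR p))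

/-- A property of functionals on `V` holds generically if it holds on a non-empty Zariski open
subset of the affine space `Hom(V, ℚ_p)`. -/
def HoldsGenerically (p : ℕ) [Fact p.Prime] (V : Type*) [AddCommGroup V] [Module ℚ_[p] V]
    [FiniteDimensional ℚ_[p] V] (S : Module.Dual ℚ_[p] V → Prop) : Prop :=
  ∃ Q : MvPolynomial (Fin (Module.finrank ℚ_[p] V)) ℚ_[p], Q ≠ 0 ∧
    ∀ φ : Module.Dual ℚ_[p] V,
      MvPolynomial.eval (fun i => φ (Module.finBasis ℚ_[p] V i)) Q ≠ 0 → S φ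

end Representations

end
end PadicHodge

namespace PadicHodge

/-! ### The ring `BdR p` is not zero. -/

section Nontriviality
variable (p : ℕ) [hp : Fact p.Prime]

/-! Let `x` be the row vector of dual coordinates of a functional `φ`. In the basis `ω` the
endomorphism `τ` is given by `A`, so `φ ∘ τ ^ i` has dual coordinates `x A ^ i`
(`bdRFunctional_comp_pow`). The polynomial `P` is a maximal minor of the matrix with rows `x, x A,
…, x A ^ k` for generic `x`: it is defined over `K`, depends only on `A` and `k`, and its entries
are linear forms, so it is homogeneous of degree `k + 1`.

Vanishing at `γ`: since `τ` commutes with Galois, all `γ ∘ τ ^ i` lie in the invariants of `Hom(V,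
ℚ_p(2a))`, a space of dimension `k`. Hence the `k + 1` functionals with `i ≤ k` satisfy a linear
relation over `ℚ_p`, the rows of the matrix satisfy the same relation, and every maximal minor
vanishes (`not_linearIndependent_comp_pow`, `det_krylov_eq_zero`).

Non-vanishing: as `k` is less than the degree of the minimal polynomial of `τ`, a functional `φ`
that is cyclic enough for the transpose of `τ` makes the `φ ∘ τ ^ i`, `i ≤ k`, independent. The
period matrix comparing a `ℚ_p`-basis of `V` with `ω` is invertible over `B_dR`, so some minor is
non-zero at this `φ`, hence non-zero as a polynomial (`exists_det_krylov_ne_zero`). A non-zero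
polynomial stays non-zero after the invertible substitution by periods, and a `ℚ_p`-linear
functional on `B_dR` turns it into a non-zero polynomial over `ℚ_p` whose non-vanishing locus is the
required open set (`MvPolynomial.exists_forall_eval₂_vecMul_ne_zero`).

About the ring `B_dR` itself only commutativity and `1 ≠ 0` are needed, not that it is a field. -/

instance isDomain_preTilt : IsDomain (PreTilt 𝓞_ℂ_[p] p) :=
  PreTilt.isDomain ℂ_[p] _ 𝓞_ℂ_[p] (PadicComplexInt.integers p) p

lemma witt_p_ne_zero : (p : WittVector p (PreTilt 𝓞_ℂ_[p] p)) ≠ 0 :=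
  WittVector.p_nonzero p _

instance isDomain_ainfInvP : IsDomain (AinfInvP 𝓞_ℂ_[p] p) :=
  IsLocalization.isDomain_localization
    (powers_le_nonZeroDivisors_of_noZeroDivisors (witt_p_ne_zero p))

/-- `p` has no `p`-th root in `A_inf`. -/
lemma witt_pow_p_ne (w : WittVector p (PreTilt 𝓞_ℂ_[p] p)) : w ^ p ≠ p := by
  intro h
  have h0 : WittVector.constantCoeff w = 0 := by
    have h1 := congrArg WittVector.constantCoeff h
    rw [map_pow, map_natCast, CharP.cast_eq_zero] at h1
    exact pow_eq_zero_iff hp.out.ne_zero |>.1 h1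
  obtain ⟨y, rfl⟩ := Ideal.mem_span_singleton.1
    ((WittVector.mem_span_p_iff_coeff_zero_eq_zero w).2 h0)
  obtain ⟨q, hq⟩ := Nat.exists_eq_add_of_le' hp.out.two_le
  -- Here `w = p y` and `p = q + 2`. Cancelling one `p` from `p ^ p * y ^ p = p` leaves a multiple
  -- of `p` equal to `1`, which is absurd in the tilt, of characteristic `p`.
  have h2 : (p : WittVector p (PreTilt 𝓞_ℂ_[p] p)) * (p * (p ^ q * y ^ p)) = p * 1 := by
    rw [mul_one]
    refine Eq.trans ?_ h
    rw [mul_pow, show (p : WittVector p (PreTilt 𝓞_ℂ_[p] p)) ^ p = p ^ (q + 2) by rw [← hq]]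
    ring
  have h3 := congrArg WittVector.constantCoeff (mul_left_cancel₀ (witt_p_ne_zero p) h2)
  rw [map_mul, map_natCast, CharP.cast_eq_zero, zero_mul, map_one] at h3
  exact zero_ne_one h3

/-- If `θ` were injective, a preimage of a `p`-th root of `p` in `𝓞_ℂ_[p]` would be a `p`-th root of
`p` in `A_inf`, which `witt_pow_p_ne` excludes. -/
lemma kerTheta_ne_bot : kerTheta 𝓞_ℂ_[p] p ≠ ⊥ := by
  intro h
  obtain ⟨y, hy⟩ := IsAlgClosed.exists_pow_nat_eq (p : ℂ_[p]) hp.out.pos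
  have hy1 : y ∈ 𝓞_ℂ_[p] := (mem_integers_iff p).2 <| by
    have h1 := (norm_p_lt_one p).le
    rw [← hy, norm_pow] at h1
    exact (pow_le_one_iff_of_nonneg (norm_nonneg _) hp.out.ne_zero).1 h1
  obtain ⟨w, hw⟩ := surjective_fontaineTheta (frobenius_surjective p) (⟨y, hy1⟩ : 𝓞_ℂ_[p])
  apply witt_pow_p_ne p w
  have hinj := IsLocalization.injective (AinfInvP 𝓞_ℂ_[p] p)
    (powers_le_nonZeroDivisors_of_noZeroDivisors (witt_p_ne_zero p))
  apply hinj
  rw [← sub_eq_zero, ← map_sub, ← Ideal.mem_bot, ← h, ← ker_thetaCp, RingHom.mem_ker,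
    thetaCp_algebraMap, map_sub, map_pow, hw, map_natCast]
  simpa [sub_eq_zero] using hy

lemma one_notMem_kerTheta : 1 ∉ kerTheta 𝓞_ℂ_[p] p := by
  rw [← ker_thetaCp, RingHom.mem_ker, map_one]
  exact one_ne_zero

/-- A product of `n` generators of `ker θ` generates `(ker θ) ^ n`. This reduces statements about
the inverted elements of the completion to ideals of the domain `A_inf[1/p]`. -/
lemma exists_span_eq_kerTheta_pow {x : BdRPlus p} (hx : x ∈ uniformizers 𝓞_ℂ_[p] p) :
    ∃ (b : AinfInvP 𝓞_ℂ_[p] p) (n : ℕ), x = toPlus _ p b ∧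
      kerTheta 𝓞_ℂ_[p] p ^ n = Ideal.span {b} := by
  induction hx using Submonoid.closure_induction with
  | mem x hx =>
    obtain ⟨a, ha, rfl⟩ := hx
    exact ⟨a, 1, rfl, by rw [pow_one]; exact ha⟩
  | one => exact ⟨1, 0, (map_one _).symm, by simp⟩
  | mul x y _ _ hx hy =>
    obtain ⟨b, n, rfl, hb⟩ := hx
    obtain ⟨c, m, rfl, hc⟩ := hy
    exact ⟨b * c, n + m, (map_mul _ _ _).symm, by
      rw [pow_add, hb, hc, Ideal.span_singleton_mul_span_singleton]⟩

/-- If a generator `b` of `(ker θ) ^ n` became zero in the completion, it would lie in `(ker θ) ^ (n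
+ 1) = ker θ * (b)`. Then `b = a b` with `a ∈ ker θ`, and cancelling `b ≠ 0` gives `1 ∈ ker θ`. -/
lemma zero_notMem_uniformizers : 0 ∉ uniformizers 𝓞_ℂ_[p] p := by
  intro h
  obtain ⟨b, n, hb0, hb⟩ := exists_span_eq_kerTheta_pow p h
  have h1 : b ∈ kerTheta 𝓞_ℂ_[p] p ^ (n + 1) := by
    rw [← Ideal.Quotient.eq_zero_iff_mem, ← evalPlus_toPlus, ← hb0, map_zero]
  rw [pow_succ', hb, Ideal.mem_mul_span_singleton] at h1
  obtain ⟨a, ha, hab⟩ := h1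
  have hbne : b ≠ 0 := by
    rintro rfl
    rw [Ideal.span_singleton_zero] at hb
    exact kerTheta_ne_bot p (eq_zero_of_pow_eq_zero hb)
  rw [mul_eq_right₀ hbne] at hab
  exact one_notMem_kerTheta p (hab ▸ ha)

/-- A localization is zero only if `0` is among the inverted elements. Non-triviality makes `K →
B_dR` injective and the determinant of an identity matrix non-zero. -/
instance nontrivial_bdR : Nontrivial (BdR p) := by
  by_contra h
  rw [not_nontrivial_iff_subsingleton] at h
  obtain ⟨c, hc⟩ := IsLocalization.exists_of_eq (M := uniformizers 𝓞_ℂ_[p] p) (S := BdR p)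
    (Subsingleton.elim (algebraMap (BdRPlus p) (BdR p) 1) (algebraMap (BdRPlus p) (BdR p) 0))
  rw [mul_one, mul_zero] at hc
  exact zero_notMem_uniformizers p (hc ▸ c.2)

end Nontriviality
end PadicHodge

/-! ### Krylov matrices and their maximal minors. -/

section Minors
open Matrix
variable {R S K : Type*} [CommRing R] [CommRing S] [CommRing K]

/-- The matrix with rows `x, x A, …, x A ^ k`. -/
def Matrix.krylov {n : Type*} [Fintype n] [DecidableEq n] (A : Matrix n n R) (k : ℕ) (x : n → R) :
    Matrix (Fin (k + 1)) n R :=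
  Matrix.of fun i => x ᵥ* A ^ (i : ℕ)

/-- A maximal minor of the Krylov matrix of `A` at the generic row vector. -/
noncomputable def Matrix.krylovMinor {m : ℕ} (A : Matrix (Fin m) (Fin m) K) (k : ℕ)
    (e : Fin (k + 1) → Fin m) : MvPolynomial (Fin m) K :=
  (((A.map MvPolynomial.C).krylov k MvPolynomial.X).submatrix id e).det

lemma Matrix.eval₂_krylovMinor {m : ℕ} (A : Matrix (Fin m) (Fin m) K) (k : ℕ)
    (e : Fin (k + 1) → Fin m) (f : K →+* R) (x : Fin m → R) :
    (A.krylovMinor k e).eval₂ f x = (((A.map f).krylov k x).submatrix id e).det := by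
  rw [← MvPolynomial.coe_eval₂Hom, krylovMinor, RingHom.map_det]
  congr 1
  ext i s
  have hA : (A.map (MvPolynomial.C (σ := Fin m))).map (MvPolynomial.eval₂Hom f x) = A.map f := by
    ext; simp
  simp only [RingHom.mapMatrix_apply, map_apply, submatrix_apply, krylov, of_apply, id_eq]
  rw [RingHom.map_vecMul, Matrix.map_pow, hA]
  congr 2
  ext t
  simp

lemma Matrix.isHomogeneous_krylovMinor {m : ℕ} (A : Matrix (Fin m) (Fin m) K) (k : ℕ)
    (e : Fin (k + 1) → Fin m) : (A.krylovMinor k e).IsHomogeneous (k + 1) := by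
  have hent : ∀ i s, MvPolynomial.IsHomogeneous
      (((A.map MvPolynomial.C).krylov k MvPolynomial.X).submatrix id e i s) 1 := by
    intro i s
    have hA : (A.map (MvPolynomial.C (σ := Fin m))) ^ (i : ℕ) =
        (A ^ (i : ℕ)).map MvPolynomial.C := by
      rw [Matrix.map_pow]
    simp only [submatrix_apply, krylov, of_apply, id_eq, hA, vecMul, dotProduct, map_apply]
    refine MvPolynomial.IsHomogeneous.sum _ _ _ fun t _ => ?_
    exact (MvPolynomial.isHomogeneous_X K t).mul (MvPolynomial.isHomogeneous_C (Fin m) _)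
  rw [krylovMinor, det_apply]
  refine MvPolynomial.IsHomogeneous.sum _ _ _ fun σ _ => ?_
  have h := MvPolynomial.IsHomogeneous.prod Finset.univ
    (fun i => ((A.map MvPolynomial.C).krylov k MvPolynomial.X).submatrix id e (σ i) i) (fun _ => 1)
    fun i _ => hent _ _
  rw [Finset.sum_const, Finset.card_univ, Fintype.card_fin, smul_eq_mul, mul_one] at h
  rw [Units.smul_def, ← MvPolynomial.mem_homogeneousSubmodule]
  exact zsmul_mem ((MvPolynomial.mem_homogeneousSubmodule _ _).2 h) _

/-- Multiplying by the adjugate turns the relation into `det M • c = 0`. One unit coefficient then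
suffices, so the base ring may have zero divisors. -/
lemma Matrix.det_eq_zero_of_vecMul_eq_zero {n : Type*} [Fintype n] [DecidableEq n]
    {M : Matrix n n R} {c : n → R} (h : c ᵥ* M = 0) {i : n} (hi : IsUnit (c i)) : M.det = 0 := by
  have h1 : c ᵥ* (M * M.adjugate) = 0 := by rw [← vecMul_vecMul, h, zero_vecMul]
  rw [mul_adjugate, vecMul_smul, vecMul_one] at h1
  have h2 := congrFun h1 i
  exact hi.mul_left_eq_zero.1 h2

/-- A matrix with a right inverse has a non-zero maximal minor. -/
lemma Matrix.exists_det_submatrix_ne_zero [Nontrivial R] {r n : Type*} [Fintype r] [DecidableEq r]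
    [Fintype n] {M : Matrix r n R} {N : Matrix n r R} (h : M * N = 1) :
    ∃ e : r → n, (M.submatrix id e).det ≠ 0 := by
  by_contra! h0
  -- The weak form of Cauchy–Binet: each column of `M * N` is a combination of columns of `M`, so
  -- multilinearity expands the determinant into maximal minors of `M`, indexed by all maps `e`,
  -- injective or not.
  have h1 : (M * N)ᵀ.det = 0 := by
    have h2 : (M * N)ᵀ = fun j => ∑ l, N l j • Mᵀ l := by
      ext j i
      simp [mul_apply, Finset.sum_apply, mul_comm]
    change detRowAlternating.toMultilinearMap (M * N)ᵀ = 0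
    rw [h2, MultilinearMap.map_sum]
    refine Finset.sum_eq_zero fun e _ => ?_
    rw [MultilinearMap.map_smul_univ]
    have h3 : (detRowAlternating.toMultilinearMap fun j => Mᵀ (e j)) = 0 := by
      rw [← h0 e, ← det_transpose]
      rfl
    rw [h3, smul_zero]
  rw [h, transpose_one, det_one] at h1
  exact one_ne_zero h1

/-- Over a field the injective map `x ↦ x M` has a linear left inverse. For row vectors composition
is multiplication on the right, so its matrix is a right inverse of `M`; as an identity of matrices
it survives extension of scalars to `B_dR`, unlike independence in general. -/
lemma Matrix.exists_mul_eq_one_of_linearIndependent {F r n : Type*} [Field F] [Fintype r]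
    [DecidableEq r] [Fintype n] [DecidableEq n] {M : Matrix r n F}
    (h : LinearIndependent F M.row) : ∃ N : Matrix n r F, M * N = 1 := by
  obtain ⟨g, hg⟩ := LinearMap.exists_leftInverse_of_injective M.vecMulLinear
    (LinearMap.ker_eq_bot.2 (Matrix.vecMul_injective_iff.2 h))
  refine ⟨LinearMap.toMatrixRight' g, ?_⟩
  apply Matrix.toLinearMapRight'.injective
  rw [Matrix.toLinearMapRight'_mul, Matrix.toLinearMapRight'_one]
  simpa [show Matrix.toLinearMapRight' M = M.vecMulLinear from rfl] using hg

end Minors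

/-! ### Functionals with independent translates under an endomorphism. -/

section CyclicVector
open Polynomial Module
variable {F V : Type*} [Field F] [AddCommGroup V] [Module F V]

/-- Every endomorphism has a vector whose annihilator is that of the whole space. -/
lemma Module.End.exists_forall_aeval_apply_eq_zero [FiniteDimensional F V] (τ : Module.End F V) :
    ∃ v : V, ∀ q : F[X], aeval τ q v = 0 → aeval τ q = 0 := by
  -- View `V` as a module over the principal ideal domain `F[X]`, with `X` acting as `τ`: some
  -- element has the annihilator of the whole module, which is generated by the minimal polynomial.
  obtain ⟨x, hx⟩ := exists_ker_toSpanSingleton_eq_annihilator F[X] (AEval' τ)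
  obtain ⟨v, rfl⟩ := (AEval'.of τ).surjective x
  refine ⟨v, fun q hq => ?_⟩
  have h1 : q ∈ Module.annihilator F[X] (AEval' τ) := by
    rw [← hx, LinearMap.mem_ker, LinearMap.toSpanSingleton_apply]
    change q • AEval.of F V τ v = 0
    rw [← AEval.of_aeval_smul, Module.End.smul_def, hq, map_zero]
  rw [← span_minpoly_eq_annihilator, Ideal.mem_span_singleton] at h1
  exact (minpoly.dvd_iff).1 h1

lemma Module.Dual.aeval_comp_apply (τ : Module.End F V) (q : F[X]) (φ : Dual F V) :
    aeval τ.dualMap q φ = φ ∘ₗ aeval τ q := by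
  induction q using Polynomial.induction_on' with
  | add p q hp hq => simp only [map_add, LinearMap.add_apply, hp, hq, LinearMap.comp_add]
  | monomial n c =>
    have h : ∀ n, (τ.dualMap ^ n) φ = φ ∘ₗ (τ ^ n) := by
      intro n
      induction n with
      | zero => rfl
      | succ n ih => rw [pow_succ', Module.End.mul_apply, ih, pow_succ]; rfl
    ext v
    simp [aeval_monomial, h, Module.algebraMap_end_apply]

/-- For a suitable functional `φ`, the functionals `φ ∘ τ ^ i` are linearly independent for
`i` smaller than the degree of the minimal polynomial of `τ`. -/
lemma Module.Dual.exists_linearIndependent_comp_pow [FiniteDimensional F V] (τ : Module.End F V) {r : ℕ}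
    (hr : r ≤ (minpoly F τ).natDegree) :
    ∃ φ : Dual F V, LinearIndependent F fun i : Fin r => φ ∘ₗ τ ^ (i : ℕ) := by
  obtain ⟨φ, hφ⟩ := Module.End.exists_forall_aeval_apply_eq_zero (τ.dualMap : Module.End F (Dual F V))
  refine ⟨φ, Fintype.linearIndependent_iff.2 fun c hc i => ?_⟩
  -- A relation among the `φ ∘ τ ^ i` says that `q` kills `φ` under the transpose. By the choice of
  -- `φ` it kills the whole dual, hence `q(τ) = 0`, and its degree is too small unless `q = 0`.
  set q : F[X] := ∑ i : Fin r, monomial (i : ℕ) (c i) with hq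
  have h1 : aeval τ.dualMap q φ = 0 := by
    rw [Module.Dual.aeval_comp_apply, ← hc, hq, map_sum]
    ext v
    simp [aeval_monomial, Module.algebraMap_end_apply]
  have h2 := hφ q h1
  have h3 : aeval τ q = 0 := by
    ext v
    refine (Module.forall_dual_apply_eq_zero_iff F _).1 fun ψ => ?_
    have := congrArg (fun T : Module.End F (Dual F V) => T ψ v) h2
    rw [Module.Dual.aeval_comp_apply] at this
    exact this
  have h4 : q.coeff i = c i := by
    rw [hq, finsetSum_coeff]
    simp [coeff_monomial, Fin.val_inj]
  rw [← h4]
  by_contra hne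
  have hq0 : q ≠ 0 := fun h => hne (by rw [h, coeff_zero])
  have h5 := natDegree_le_of_dvd (minpoly.dvd F τ h3) hq0
  have h6 : q.natDegree < r := by
    rw [natDegree_lt_iff_degree_lt hq0, hq]
    simp_rw [← C_mul_X_pow_eq_monomial]
    exact degree_sum_fin_lt c
  omega

end CyclicVector

/-! ### Non-vanishing at generic points defined over a subfield. -/

section Generic
variable {F B K : Type*} [Field F] [CommRing B] [Algebra F B]

/-- A non-zero polynomial over an `F`-algebra does not vanish on the `F`-points of a non-empty
open set defined over `F`. -/
lemma MvPolynomial.exists_forall_eval_ne_zero {σ : Type*} {R : MvPolynomial σ B} (hR : R ≠ 0) :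
    ∃ Q : MvPolynomial σ F, Q ≠ 0 ∧
      ∀ y : σ → F, eval y Q ≠ 0 → eval (fun i => algebraMap F B (y i)) R ≠ 0 := by
  classical
  obtain ⟨d, hd⟩ := ne_zero_iff.1 hR
  -- Applying `l` to every coefficient of `R` gives a polynomial `Q` with `Q(y) = l(R(y))` at
  -- `F`-points `y`, and `Q ≠ 0` because `l` does not kill the coefficient at `d`.
  obtain ⟨l, hl⟩ : ∃ l : Module.Dual F B, l (coeff d R) ≠ 0 := by
    by_contra! h
    exact hd ((Module.forall_dual_apply_eq_zero_iff F _).1 h)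
  refine ⟨∑ s ∈ R.support, monomial s (l (coeff s R)), fun h => ?_, fun y hy h => hy ?_⟩
  · have h1 := congrArg (coeff d) h
    rw [coeff_sum] at h1
    simp only [coeff_monomial, Finset.sum_ite_eq', mem_support_iff, coeff_zero] at h1
    rw [if_pos hd] at h1
    exact hl h1
  · rw [map_sum]
    have h2 := congrArg l h
    rw [eval_eq, map_sum, map_zero] at h2
    rw [← h2]
    refine Finset.sum_congr rfl fun s _ => ?_
    have h3 : coeff s R * ∏ i ∈ s.support, algebraMap F B (y i) ^ s i =
        (∏ i ∈ s.support, y i ^ s i) • coeff s R := by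
      rw [Algebra.smul_def, mul_comm, map_prod]
      simp
    rw [h3, map_smul, eval_monomial, smul_eq_mul, mul_comm]
    rfl

/-- A non-zero polynomial does not vanish at a generic `F`-point of an invertible linear
substitution with coefficients in an `F`-algebra. -/
lemma MvPolynomial.exists_forall_eval₂_vecMul_ne_zero [CommRing K] {σ ι : Type*} [Fintype σ]
    [Fintype ι] [DecidableEq σ] {f : K →+* B}
    (hf : Function.Injective f) {P : MvPolynomial σ K} (hP : P ≠ 0) {M : Matrix ι σ B}
    {N : Matrix σ ι B} (h : N * M = 1) :
    ∃ Q : MvPolynomial ι F, Q ≠ 0 ∧ ∀ y : ι → F, eval y Q ≠ 0 →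
      P.eval₂ f (Matrix.vecMul (fun i => algebraMap F B (y i)) M) ≠ 0 := by
  let x : σ → MvPolynomial ι B := Matrix.vecMul X (M.map C)
  -- Substituting `X N` into `P(X M)` gives `P(X N M) = P(X)`, the image of `P` under the injective
  -- `f`, so the substituted polynomial cannot vanish.
  have hR : P.eval₂ (C.comp f) x ≠ 0 := by
    intro h0
    have h1 := congrArg (eval₂Hom (C (σ := σ)) (Matrix.vecMul X (N.map C))) h0
    rw [map_zero, ← coe_eval₂Hom, ← RingHom.comp_apply, comp_eval₂Hom] at h1
    have h2 : (fun i => eval₂Hom (C (σ := σ)) (Matrix.vecMul X (N.map C)) (x i)) = X := by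
      have hM : (M.map (C (σ := ι))).map (eval₂Hom (C (σ := σ)) (Matrix.vecMul X (N.map C))) =
          M.map C := by ext; simp
      have hX : (eval₂Hom (C (σ := σ)) (Matrix.vecMul X (N.map C))) ∘ X =
          Matrix.vecMul X (N.map C) := by ext; simp
      ext1 i
      rw [RingHom.map_vecMul, hM, hX, Matrix.vecMul_vecMul, ← Matrix.map_mul, h,
        Matrix.map_one _ C.map_zero C.map_one, Matrix.vecMul_one]
    rw [h2, ← RingHom.comp_assoc, show (eval₂Hom (C (σ := σ)) (Matrix.vecMul X (N.map C))).comp C = C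
      from RingHom.ext fun _ => by simp] at h1
    apply hP
    apply map_injective f hf
    rw [map_zero, show map f = eval₂Hom (C.comp f) X from
      ringHom_ext (fun _ => by simp) (fun _ => by simp), h1]
  obtain ⟨Q, hQ, h1⟩ := exists_forall_eval_ne_zero (F := F) hR
  refine ⟨Q, hQ, fun y hy h2 => h1 y hy ?_⟩
  rw [← h2, ← coe_eval₂Hom (C.comp f), ← RingHom.comp_apply, comp_eval₂Hom, coe_eval₂Hom]
  congr 1
  · ext; simp
  · have hM : (M.map (C (σ := ι))).map (eval fun i => algebraMap F B (y i)) = M := by ext; simp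
    ext1 i
    rw [RingHom.map_vecMul, hM]
    congr 1
    ext; simp

end Generic

namespace PadicHodge
-- Dual coordinates, and minors at Galois-equivariant and at generic functionals.
section Relation
open Matrix Module
variable {p : ℕ} [hp : Fact p.Prime] {V : Type*} [AddCommGroup V] [Module ℚ_[p] V]

lemma bdRFunctional_tmul (z : CompatibleRoots p) (a : ℤ) (φ : Dual ℚ_[p] V) (b : BdR p) (v : V) :
    bdRFunctional z a φ (b ⊗ₜ v) = z.tPow a * (φ v • b) := by
  simp [bdRFunctional]

lemma bdRFunctional_comp (z : CompatibleRoots p) (a : ℤ) (φ : Dual ℚ_[p] V)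
    (τ : Module.End ℚ_[p] V) (x : BdR p ⊗[ℚ_[p]] V) :
    bdRFunctional z a (φ ∘ₗ τ) x = bdRFunctional z a φ (τ.baseChange (BdR p) x) := by
  simp [bdRFunctional, LinearMap.baseChange_comp]

lemma bdRFunctional_sum_smul (z : CompatibleRoots p) (a : ℤ) {ι : Type*} [Fintype ι]
    (c : ι → ℚ_[p]) (φ : ι → Dual ℚ_[p] V) (x : BdR p ⊗[ℚ_[p]] V) :
    bdRFunctional z a (∑ i, c i • φ i) x =
      ∑ i, algebraMap ℚ_[p] (BdR p) (c i) * bdRFunctional z a (φ i) x := by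
  induction x with
  | zero => simp
  | add x y hx hy => simp only [map_add, hx, hy, mul_add, Finset.sum_add_distrib]
  | tmul b v =>
    simp only [bdRFunctional_tmul, LinearMap.sum_apply, LinearMap.smul_apply, Finset.sum_smul,
      Finset.mul_sum]
    refine Finset.sum_congr rfl fun i _ => ?_
    rw [smul_assoc, mul_smul_comm, Algebra.smul_def]

variable {m : ℕ} {w : Fin m → BdR p ⊗[ℚ_[p]] V} {τ : Module.End ℚ_[p] V}
  {A : Matrix (Fin m) (Fin m) (BdR p)}

/-- The dual coordinates of `φ ∘ τ ^ i` in terms of those of `φ`. -/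
lemma bdRFunctional_comp_pow (hw : ∀ s, τ.baseChange (BdR p) (w s) = ∑ r, A r s • w r)
    (z : CompatibleRoots p) (a : ℤ) (φ : Dual ℚ_[p] V) (i : ℕ) :
    (fun s => bdRFunctional z a (φ ∘ₗ τ ^ i) (w s)) =
      (fun s => bdRFunctional z a φ (w s)) ᵥ* A ^ i := by
  induction i generalizing φ with
  | zero => rw [pow_zero, pow_zero, vecMul_one]; rfl
  | succ i ih =>
    rw [pow_succ A, ← vecMul_vecMul, ← ih]
    ext s
    rw [pow_succ, Module.End.mul_eq_comp, ← LinearMap.comp_assoc, bdRFunctional_comp, hw, map_sum]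
    simp only [vecMul, dotProduct, map_smul, smul_eq_mul, mul_comm]

/-- The relation over `ℚ_p` passes to the rows because `bdRFunctional` is linear in the functional;
the factor `t ^ a` is common to all rows. A non-zero coefficient in `ℚ_p` maps to a unit of `B_dR`.
-/
lemma det_krylov_eq_zero (hw : ∀ s, τ.baseChange (BdR p) (w s) = ∑ r, A r s • w r)
    (z : CompatibleRoots p) (a : ℤ) (φ : Dual ℚ_[p] V) {k : ℕ}
    (h : ¬ LinearIndependent ℚ_[p] fun i : Fin (k + 1) => φ ∘ₗ τ ^ (i : ℕ))
    (e : Fin (k + 1) → Fin m) :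
    ((A.krylov k fun s => bdRFunctional z a φ (w s)).submatrix id e).det = 0 := by
  obtain ⟨c, hc, i, hi⟩ := Fintype.not_linearIndependent_iff.1 h
  refine det_eq_zero_of_vecMul_eq_zero (c := fun i => algebraMap ℚ_[p] (BdR p) (c i)) ?_
    (i := i) ((IsUnit.mk0 _ hi).map _)
  ext s
  have h1 := bdRFunctional_sum_smul z a c (fun i : Fin (k + 1) => φ ∘ₗ τ ^ (i : ℕ)) (w (e s))
  rw [hc] at h1
  have h2 : bdRFunctional z a (0 : Dual ℚ_[p] V) (w (e s)) = 0 := by simp [bdRFunctional]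
  rw [h2] at h1
  rw [Pi.zero_apply, h1]
  change ∑ i, algebraMap ℚ_[p] (BdR p) (c i) *
    A.krylov k (fun s => bdRFunctional z a φ (w s)) i (e s) = _
  refine Finset.sum_congr rfl fun i _ => ?_
  exact congrArg _ (congrFun (bdRFunctional_comp_pow hw z a φ i) (e s)).symm

/-- The matrix on the right is the period matrix. It separates the `ℚ_p`-rational coordinates of `φ`
from the transcendental part; in twist `0` the factor `t ^ 0` is `1`. -/
lemma bdRFunctional_basis {ι : Type*} [Fintype ι] (e : Basis ι ℚ_[p] V)
    (b : Basis (Fin m) (BdR p) (BdR p ⊗[ℚ_[p]] V)) (z : CompatibleRoots p) (φ : Dual ℚ_[p] V) :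
    (fun s => bdRFunctional z 0 φ (b s)) =
      (fun l => algebraMap ℚ_[p] (BdR p) (φ (e l))) ᵥ* (e.baseChange (BdR p)).toMatrix b := by
  ext s
  conv_lhs => rw [← (e.baseChange (BdR p)).sum_repr (b s)]
  simp only [map_sum, vecMul, dotProduct, Basis.toMatrix_apply, map_smul, Basis.baseChange_apply,
    bdRFunctional_tmul]
  refine Finset.sum_congr rfl fun l _ => ?_
  simp [CompatibleRoots.tPow, Algebra.smul_def, mul_comm]

/-- The Krylov matrix factors as the `ℚ_p`-matrix of the `φ ∘ τ ^ i` in the basis `e`, which has a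
right inverse by independence, times the invertible period matrix. It therefore has a right inverse
over `B_dR`. -/
lemma exists_det_krylov_ne_zero {ι : Type*} [Fintype ι] (e : Basis ι ℚ_[p] V)
    (b : Basis (Fin m) (BdR p) (BdR p ⊗[ℚ_[p]] V))
    (hb : ∀ s, τ.baseChange (BdR p) (b s) = ∑ r, A r s • b r)
    (z : CompatibleRoots p) {φ : Dual ℚ_[p] V} {k : ℕ}
    (h : LinearIndependent ℚ_[p] fun i : Fin (k + 1) => φ ∘ₗ τ ^ (i : ℕ)) :
    ∃ s : Fin (k + 1) → Fin m,
      ((A.krylov k fun s => bdRFunctional z 0 φ (b s)).submatrix id s).det ≠ 0 := by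
  classical
  let M : Matrix (Fin (k + 1)) ι ℚ_[p] := of fun i l => (φ ∘ₗ τ ^ (i : ℕ)) (e l)
  have hM : LinearIndependent ℚ_[p] M.row := by
    refine Fintype.linearIndependent_iff.2 fun c hc => Fintype.linearIndependent_iff.1 h c ?_
    refine e.ext fun l => ?_
    have := congrFun hc l
    simpa [M, Matrix.row, Finset.sum_apply] using this
  obtain ⟨N, hN⟩ := exists_mul_eq_one_of_linearIndependent hM
  refine exists_det_submatrix_ne_zero
    (N := b.toMatrix (e.baseChange (BdR p)) * N.map (algebraMap ℚ_[p] (BdR p))) ?_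
  have h1 : (A.krylov k fun s => bdRFunctional z 0 φ (b s)) =
      M.map (algebraMap ℚ_[p] (BdR p)) * (e.baseChange (BdR p)).toMatrix b := by
    ext i s
    have h2 := congrFun ((bdRFunctional_comp_pow hb z 0 φ i).symm.trans
      (bdRFunctional_basis e b z (φ ∘ₗ τ ^ (i : ℕ)))) s
    exact h2
  rw [h1, Matrix.mul_assoc, ← Matrix.mul_assoc (Basis.toMatrix _ _),
    Basis.toMatrix_mul_toMatrix_flip, Matrix.one_mul, ← Matrix.map_mul, hN,
    Matrix.map_one _ (map_zero _) (map_one _)]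

/-- The functionals `γ ∘ τ ^ i` are invariant in `Hom(V, ℚ_p(2a))`, for `τ` equivariant and `γ` a
functional on which Galois acts through `χ ^ (-a)` in `Hom(V, ℚ_p(a))`. -/
lemma comp_pow_mem_invariants {Kv : IntermediateField ℚ_[p] (PadicAlgCl p)}
    {ρ : Representation ℚ_[p] Gal(PadicAlgCl p/Kv) V} (hτ : ∀ g, τ ∘ₗ ρ g = ρ g ∘ₗ τ)
    {a : ℤ} {γ : Dual ℚ_[p] V}
    (hγ : ∀ g, (ρ.linHom (tateTwist Kv a)) g γ = ((cyclo Kv g ^ (-a) : ℚ_[p]ˣ) : ℚ_[p]) • γ)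
    (i : ℕ) : γ ∘ₗ τ ^ i ∈ (ρ.linHom (tateTwist Kv (2 * a))).invariants := by
  intro g
  have hc : ∀ v, (τ ^ i) (ρ g⁻¹ v) = ρ g⁻¹ ((τ ^ i) v) := by
    intro v
    have h : Commute τ (ρ g⁻¹) := hτ g⁻¹
    exact LinearMap.congr_fun (h.pow_left i).eq v
  ext v
  have h1 := LinearMap.congr_fun (hγ g) ((τ ^ i) v)
  simp only [Representation.linHom_apply, LinearMap.comp_apply, tateTwist, MonoidHom.coe_mk,
    OneHom.coe_mk, LinearMap.smul_apply, LinearMap.id_apply, smul_eq_mul] at h1 ⊢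
  -- Split `χ ^ (2a)` as `χ ^ a * χ ^ a`: one factor completes the action on `Hom(V, ℚ_p(a))`, which
  -- is by `χ ^ (-a)`, and the other cancels the result.
  rw [hc, two_mul, _root_.zpow_add, Units.val_mul, mul_assoc, h1, ← mul_assoc, ← Units.val_mul,
    ← _root_.zpow_add, add_neg_cancel, zpow_zero, Units.val_one, one_mul]

/-- These are `k + 1` vectors in the space of invariants, which has dimension `k`. -/
lemma not_linearIndependent_comp_pow [FiniteDimensional ℚ_[p] V]
    {Kv : IntermediateField ℚ_[p] (PadicAlgCl p)}
    {ρ : Representation ℚ_[p] Gal(PadicAlgCl p/Kv) V} (hτ : ∀ g, τ ∘ₗ ρ g = ρ g ∘ₗ τ)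
    {a : ℤ} {γ : Dual ℚ_[p] V}
    (hγ : ∀ g, (ρ.linHom (tateTwist Kv a)) g γ = ((cyclo Kv g ^ (-a) : ℚ_[p]ˣ) : ℚ_[p]) • γ)
    {k : ℕ} (hk : finrank ℚ_[p] (ρ.linHom (tateTwist Kv (2 * a))).invariants = k) :
    ¬ LinearIndependent ℚ_[p] fun i : Fin (k + 1) => γ ∘ₗ τ ^ (i : ℕ) := by
  intro h
  let u : Fin (k + 1) → (ρ.linHom (tateTwist Kv (2 * a))).invariants := fun i =>
    ⟨γ ∘ₗ τ ^ (i : ℕ), comp_pow_mem_invariants hτ hγ i⟩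
  have hu : LinearIndependent ℚ_[p] u := LinearIndependent.of_comp (Submodule.subtype _) h
  have := hu.fintype_card_le_finrank
  rw [Fintype.card_fin, hk] at this
  omega

end Relation
end PadicHodge

/-! ### The main theorem. -/

open PadicHodge in
theorem mainTheorem11 (K : Type*) [Field K] [NumberField K] (m k : ℕ)
    (A : Matrix (Fin m) (Fin m) K) :
    -- the relation depends only on the matrix `A` of `τ` (and on its degree `k + 1`)
    ∃ P : MvPolynomial (Fin m) K,
      ∀ (p : ℕ) [Fact p.Prime] (Kv : IntermediateField ℚ_[p] (PadicAlgCl p))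
        [FiniteDimensional ℚ_[p] Kv] [Algebra K Kv]
        -- a continuous `B_dR`-admissible representation of `G_{K_v}`
        (V : Type*) [AddCommGroup V] [Module ℚ_[p] V] [FiniteDimensional ℚ_[p] V]
        (ρ : Representation ℚ_[p] Gal(PadicAlgCl p/Kv) V)
        (_ : IsContinuousRep ρ) (_ : IsBdRAdmissible ρ)
        -- a `K`-structure on `D_dR(V)`
        [Module K (DdR ρ)] [IsScalarTower K Kv (DdR ρ)]
        (VdR : Type*) [AddCommGroup VdR] [Module K VdR]
        (j : VdR →ₗ[K] DdR ρ) (_ : IsBaseChange Kv j)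
        -- an equivariant endomorphism of `V` whose de Rham realization is defined over `K`
        (τ : Module.End ℚ_[p] V) (hτ : ∀ g, τ ∘ₗ ρ g = ρ g ∘ₗ τ)
        (τK : Module.End K VdR) (_ : ∀ x, deRhamRealization ρ τ hτ (j x) = j (τK x))
        -- a functional `V → ℚ_p(a)` on which `G_{K_v}` acts through `χ ^ (-a)`
        (a : ℤ) (γ : V →ₗ[ℚ_[p]] ℚ_[p])
        (_ : ∀ g, (ρ.linHom (tateTwist Kv a)) g γ = ((cyclo Kv g ^ (-a) : ℚ_[p]ˣ) : ℚ_[p]) • γ)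
        -- the dimension of the invariants is less than the degree of the minimal polynomial
        (_ : Module.finrank ℚ_[p] (ρ.linHom (tateTwist Kv (2 * a))).invariants = k)
        (_ : k < (minpoly ℚ_[p] τ).natDegree)
        -- a basis of the `K`-structure in which `τ` has the matrix `A`
        (ω : Module.Basis (Fin m) K VdR) (_ : LinearMap.toMatrix ω ω τK = A)
        -- the choice of `p`-power roots of unity that defines the period `t`
        (z : CompatibleRoots p),
        P.totalDegree = k + 1 ∧ P.IsHomogeneous (k + 1) ∧
        P.eval₂ ((algebraMap Kv (BdR p)).comp (algebraMap K Kv))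
          (fun i => bdRFunctional z a γ (j (ω i))) = 0 ∧
        HoldsGenerically p V fun φ =>
          P.eval₂ ((algebraMap Kv (BdR p)).comp (algebraMap K Kv))
            (fun i => bdRFunctional z 0 φ (j (ω i))) ≠ 0 := by
  -- `P` must be fixed before `p` and `V` are known, so it is any non-zero minor if there is one.
  -- The default `0` is harmless: a representation satisfying the hypotheses forces a non-zero minor
  -- to exist.
  obtain ⟨P, hhom, hP⟩ : ∃ P : MvPolynomial (Fin m) K, P.IsHomogeneous (k + 1) ∧
      ((∃ s, A.krylovMinor k s ≠ 0) → P ≠ 0 ∧ ∃ s, P = A.krylovMinor k s) := by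
    by_cases h : ∃ s, A.krylovMinor k s ≠ 0
    · obtain ⟨s, hs⟩ := h
      exact ⟨_, A.isHomogeneous_krylovMinor k s, fun _ => ⟨hs, s, rfl⟩⟩
    · exact ⟨0, MvPolynomial.isHomogeneous_zero _ _ _, fun h' => absurd h' h⟩
  refine ⟨P, ?_⟩
  intro p _ Kv _ _ V _ _ _ ρ _ hadm _ _ VdR _ _ j hj τ hτ τK hτK a γ hγ hk hdeg ω hA z
  set f := (algebraMap Kv (BdR p)).comp (algebraMap K Kv)
  -- The `K`-structure makes `ω` a `K_v`-basis of `D_dR(V)`, and admissibility makes that a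
  -- `B_dR`-basis of `B_dR ⊗ V`.
  let b : Module.Basis (Fin m) (BdR p) (BdR p ⊗[ℚ_[p]] V) :=
    IsBaseChange.basis (IsBaseChange.basis ω hj) hadm
  have hbj : ∀ s, (j (ω s) : BdR p ⊗[ℚ_[p]] V) = b s := fun s => by
    have h1 : b s = IsBaseChange.basis ω hj s :=
      IsBaseChange.basis_apply (ε := (DdR ρ).subtype) (IsBaseChange.basis ω hj) hadm s
    rw [h1, IsBaseChange.basis_apply]
  have hb : ∀ s, τ.baseChange (BdR p) (b s) = ∑ r, (A.map f) r s • b r := by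
    intro s
    have h1 : τ.baseChange (BdR p) (b s) = (deRhamRealization ρ τ hτ (j (ω s)) : DdR ρ) := by
      rw [← hbj]
      rfl
    rw [h1, hτK, ← ω.sum_repr (τK (ω s)), map_sum, Submodule.coe_sum]
    refine Finset.sum_congr rfl fun r _ => ?_
    have h2 : ω.repr (τK (ω s)) r = A r s := by rw [← hA, LinearMap.toMatrix_apply]
    rw [map_smul, h2, ← algebraMap_smul Kv (A r s) (j (ω r)), Submodule.coe_smul, hbj]
    exact (algebraMap_smul (BdR p) (algebraMap K Kv (A r s)) (b r)).symm
  simp only [hbj]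
  let e := Module.finBasis ℚ_[p] V
  -- A minor with a non-zero value over `B_dR` is a non-zero polynomial over `K`. The strict
  -- inequality `hdeg` is what allows all `k + 1` powers `τ ^ 0, …, τ ^ k`.
  obtain ⟨hP0, s, rfl⟩ := hP <| by
    obtain ⟨φ, hφ⟩ := Module.Dual.exists_linearIndependent_comp_pow τ hdeg
    obtain ⟨s, hs⟩ := exists_det_krylov_ne_zero e b hb z hφ
    refine ⟨s, fun h => hs ?_⟩
    rw [← Matrix.eval₂_krylovMinor, h, MvPolynomial.eval₂_zero]
  refine ⟨hhom.totalDegree hP0, hhom, ?_, ?_⟩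
  · rw [Matrix.eval₂_krylovMinor]
    exact det_krylov_eq_zero hb z a γ (not_linearIndependent_comp_pow hτ hγ hk) s
  -- The substitution is by the period matrix, with the opposite change of basis as inverse; `Q` is
  -- then a polynomial in the values of `φ` on the basis `e`.
  · obtain ⟨Q, hQ, h⟩ := MvPolynomial.exists_forall_eval₂_vecMul_ne_zero (F := ℚ_[p])
      f.injective hP0 (b.toMatrix_mul_toMatrix_flip (e.baseChange (BdR p)))
    refine ⟨Q, hQ, fun φ hφ => ?_⟩
    have h1 := h _ hφ
    rwa [← bdRFunctional_basis e b z φ] at h1
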